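/- Let $r\ge 0$, let $\mathcal M_r(\mathbb C)$ be the space of complex $r\times r$ matrices with the real inner product $\langle A,B\rangle=\operatorname{Re}\operatorname{tr}(B^*A)$ and its (Frobenius) norm, let $D=\operatorname{diag}(d_1,\dots,d_r)$ be an invertible diagonal matrix, and let $\lambda\in(0,1)$. Write $\mathcal S(D)=\{SDS^{-1}: S \text{ invertible}\}$ for the similarity orbit and $\mathcal U(D)=\{UDU^*: U\in\mathcal U(r)\}$ for the unitary orbit of $D$; both are $C^\infty$ submanifolds of $\mathcal M_r(\mathbb C)$. For a matrix $T$ with polar decomposition $T=U|T|$, let $\Delta_\lambda(T)=|T|^\lambda U|T|^{1-\lambda}$. Write $d_j=|d_j|e^{i\theta_j}$ with $\theta_j\in(-\pi,\pi]$, and let $$ k_{D,\lambda}=\max\left\{\max_{|d_i|\ne|d_j|}\frac{|d_j|^{1-\lambda}|d_i|^{\lambda}+|d_i|^{1-\lambda}|d_j|^{\lambda}}{|d_i|+|d_j|},\ \max_{\theta_i\ne\theta_j}\left|\lambda\left(e^{i(\theta_j-\theta_i)}-1\right)+1\right|\right\}, $$ where a maximum over the empty set is $0$. Then $\Delta_\lambda$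 maps $\mathcal S(D)$ into itself and is a $C^\infty$ map $\mathcal S(D)\to\mathcal S(D)$; it fixes every point of $\mathcal U(D)$; $k_{D,\lambda}<1$; and for every $N\in\mathcal U(D)$ there is a real linear subspace $\mathcal E^s_{N,\lambda}$ of the tangent space $T_N\mathcal S(D)$ such that: 1. $T_N\mathcal S(D)=\mathcal E^s_{N,\lambda}\oplus T_N\mathcal U(D)$; 2. both $\mathcal E^s_{N,\lambda}$ and $T_N\mathcal U(D)$ are invariant under the derivative $T_N\Delta_\lambda:T_N\mathcal S(D)\to T_N\mathcal S(D)$; 3. $\left\|T_N\Delta_\lambda|_{\mathcal E^s_{N,\lambda}}\right\|\le k_{D,\lambda}$; 4. if $U\in\mathcal U(r)$ satisfies $N=UDU^*$, then $\mathcal E^s_{N,\lambda}=U\,\mathcal E^s_{D,\lambda}\,U^*$. Moreover $N\mapsto\mathcal E^s_{N,\lambda}$ is smooth on $\mathcal U(D)$, in the following sense: let $P_{N,\lambda}$ be the real linear operator on $\mathcal M_r(\mathbb C)$ that is the projection onto $\mathcal E^s_{N,\lambda}$ parallel to $T_N\mathcal U(D)$ on $T_N\mathcal S(D)$ and is $0$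 on the orthogonal complement of $T_N\mathcal S(D)$; then $N\mapsto P_{N,\lambda}$ is a $C^\infty$ map on $\mathcal U(D)$. -/

import Mathlib

open scoped Matrix ContDiff Topology

-- The norm on complex matrices is the Frobenius norm, i.e. the norm of the real inner product
-- `⟨A, B⟩ = Re tr (B* A)`.
attribute [local instance] Matrix.frobeniusNormedAddCommGroup Matrix.frobeniusNormedSpace

namespace Aluthge

section Submanifold

variable {E F : Type*} [NormedAddCommGroup E] [NormedSpace ℝ E]
  [NormedAddCommGroup F] [NormedSpace ℝ F]

/-- `f` is of class `C^∞` on the subset `S` of the vector space `E`: near each point of `S` it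
coincides on `S` with a `C^∞` map defined on an open subset of `E`. For an embedded submanifold
`S` this is smoothness of `f` as a map on the manifold `S`. -/
def SmoothOnSubset (f : E → F) (S : Set E) : Prop :=
  ∀ x ∈ S, ∃ (W : Set E) (g : E → F),
    IsOpen W ∧ x ∈ W ∧ ContDiffOn ℝ ∞ g W ∧ Set.EqOn f g (S ∩ W)

/-- `γ` is a `C^∞` curve, defined near time `0` and running in `S`, which passes through `x` at
time `0` with velocity `v`. -/
structure IsSmoothCurve (S : Set E) (x v : E) (γ : ℝ → E) : Prop where
  smooth : ∀ᶠ t in 𝓝 (0 : ℝ), ContDiffAt ℝ ∞ γ t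
  mem : ∀ᶠ t in 𝓝 (0 : ℝ), γ t ∈ S
  base : γ 0 = x
  velocity : HasDerivAt γ v 0

/-- The tangent space at `x` of `S ⊆ E`: the space of velocities of smooth curves in `S` through
`x` (for a submanifold the velocities already form a subspace, and the span adds nothing). -/
def tangentSpaceAt (S : Set E) (x : E) : Submodule ℝ E :=
  Submodule.span ℝ {v | ∃ γ, IsSmoothCurve S x v γ}

theorem IsSmoothCurve.mem_tangentSpaceAt {S : Set E} {x v : E} {γ : ℝ → E}
    (h : IsSmoothCurve S x v γ) : v ∈ tangentSpaceAt S x :=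
  Submodule.subset_span ⟨γ, h⟩

/-- `L` is the derivative `T_x f : T_x S → T_x S` of the map `f : S → S` at a fixed point `x` of
`f`: it sends the velocity of each smooth curve `γ` in `S` through `x` to the velocity of `f ∘ γ`.
As the velocities span `T_x S`, this determines `L`. -/
def IsTangentMap (f : E → E) (S : Set E) (x : E)
    (L : tangentSpaceAt S x →ₗ[ℝ] tangentSpaceAt S x) : Prop :=
  ∀ (v : E) (γ : ℝ → E) (h : IsSmoothCurve S x v γ),
    HasDerivAt (fun t => f (γ t)) (L ⟨v, h.mem_tangentSpaceAt⟩ : E) 0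

/-- The normed space of bounded operators on `E`, with the topology given by the norm of `E`. -/
abbrev BoundedOperator (E : Type*) [NormedAddCommGroup E] [NormedSpace ℝ E] := E →L[ℝ] E

end Submanifold

/-- The complex `r × r` matrices. -/
abbrev Mat (r : ℕ) := Matrix (Fin r) (Fin r) ℂ

/-- The similarity orbit `{S D S⁻¹ : S invertible}`. -/
def similarityOrbit {r : ℕ} (D : Mat r) : Set (Mat r) :=
  {T | ∃ S : Mat r, IsUnit S ∧ T = S * D * S⁻¹}

/-- The unitary orbit `{U D U* : U unitary}`. -/
def unitaryOrbit {r : ℕ} (D : Mat r) : Set (Mat r) :=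
  {N | ∃ U ∈ Matrix.unitaryGroup (Fin r) ℂ, N = U * D * Uᴴ}

/-- The modulus `|T| = (T* T)^{1/2}`. -/
noncomputable def modulus {r : ℕ} (T : Mat r) : Mat r :=
  cfc Real.sqrt (Tᴴ * T)

/-- The power `|T|^s`, through the functional calculus of the positive matrix `|T|`. -/
noncomputable def modulusPow {r : ℕ} (T : Mat r) (s : ℝ) : Mat r :=
  cfc (fun x : ℝ => x ^ s) (modulus T)

/-- The partial isometry `U` of the polar decomposition `T = U |T|`, with `ker U = ker T`. It is
`T |T|⁺`, where the pseudoinverse `|T|⁺` inverts the nonzero eigenvalues of `|T|` and keeps the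
eigenvalue `0` (recall `0⁻¹ = 0`). -/
noncomputable def polarFactor {r : ℕ} (T : Mat r) : Mat r :=
  T * cfc (fun x : ℝ => x⁻¹) (modulus T)

/-- The `λ`-Aluthge transform `|T|^λ U |T|^{1-λ}`, where `T = U |T|` is the polar decomposition. -/
noncomputable def aluthge {r : ℕ} (lam : ℝ) (T : Mat r) : Mat r :=
  modulusPow T lam * polarFactor T * modulusPow T (1 - lam)

/-- The constant `k_{D,λ}` for `D = diag (d 0, …, d (r-1))`. Both suprema are over finite sets, so
they are maxima, and the supremum over the empty set is `0`. The argument of a nonzero `d i` is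
taken in `(-π, π]`, so that equal arguments are equal numbers. -/
noncomputable def contractionConst {r : ℕ} (d : Fin r → ℂ) (lam : ℝ) : ℝ :=
  max
    (⨆ p : {p : Fin r × Fin r // ‖d p.1‖ ≠ ‖d p.2‖},
      (‖d p.1.2‖ ^ (1 - lam) * ‖d p.1.1‖ ^ lam + ‖d p.1.1‖ ^ (1 - lam) * ‖d p.1.2‖ ^ lam) /
        (‖d p.1.1‖ + ‖d p.1.2‖))
    (⨆ p : {p : Fin r × Fin r // (d p.1).arg ≠ (d p.2).arg},
      ‖(lam : ℂ) *
        (Complex.exp (Complex.I * (((d p.1.2).arg - (d p.1.1).arg : ℝ) : ℂ)) - 1) + 1‖)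

end Aluthge

open Aluthge

/-! For invertible `T` the polar factor is `T|T|⁻¹`, so `Δ(T) = F T F⁻¹` with `F = |T|^λ =
(T*T)^(λ/2)`. Hence `Δ` preserves the similarity orbit, commutes with unitary conjugation and fixes
the unitary orbit. It is smooth because, near a positive definite matrix, the power is a binomial
series centred at a scalar matrix (`contDiffAt_binomialPow`).

The derivative at `D` comes from differentiating identities rather than the series. From `Q F(Q) =
F(Q) Q` one finds that the derivative of the power at a diagonal matrix multiplies off-diagonal
entries by divided differences; from `Δ(T) F(T*T) = F(T*T) T` one then gets that of `Δ`. Write a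
tangent vector as `Y = XD - DX` with `X_ij = Y_ij / (d_j - d_i)`. It is tangent to the unitary orbit
exactly when `X` is skew-Hermitian, that is, when `w = X + X*` (`transversalCoord`) vanishes. By
`fderiv_aluthge_diagonal_sub`, `B = T_DΔ - 1` sends `Y` to the matrix `(d_j - d_i) c_ij w_ij`. So
`B` kills the unitary directions and acts on its own range entrywise, through `μ_ij = c_ij + conj
c_ji` (`aluthgeEig`). A computation gives `|1 + μ_ij| ≤ k < 1` whenever `d_i ≠ d_j`, so these `μ_ij`
are nonzero. The range of `B` is therefore the required space: it complements the unitary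
directions, and `1 + B` contracts it by `k`.

Unitary conjugation carries this to every `N`. The operators `B_N` are conjugate, so one polynomial
`m` with `m(0) ≠ 0` and `m(B)B = 0` serves them all, and `P_N = 1 - m(B_N)/m(0)` is smooth in `N`.
-/

namespace Aluthge

/-! ### Smooth matrix powers by the binomial series -/

section BinomialPow

variable {r : ℕ}

/-- Only `‖1‖ ≤ 1` is asked, since for `r = 0` the operator algebra is trivial and `1 = 0`. The
coefficients are dominated by those of the scalar series. -/
theorem one_le_binomialSeries_radius {𝔸 : Type*} [NormedRing 𝔸] [NormedAlgebra ℂ 𝔸]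
    (h1 : ‖(1 : 𝔸)‖ ≤ 1) (s : ℂ) : 1 ≤ (binomialSeries 𝔸 s).radius := by
  refine (binomialSeries_radius_ge_one (𝔸 := ℂ) (a := s)).trans ?_
  refine FormalMultilinearSeries.radius_le_of_le fun {n} => ?_
  change ‖FormalMultilinearSeries.ofScalars 𝔸 (Ring.choose s ·) n‖ ≤
    ‖FormalMultilinearSeries.ofScalars ℂ (Ring.choose s ·) n‖
  rw [FormalMultilinearSeries.ofScalars_norm ℂ]
  rcases n.eq_zero_or_pos with rfl | hn
  · rw [FormalMultilinearSeries.ofScalars_norm_eq_mul, ContinuousMultilinearMap.norm_mkPiAlgebraFin_zero]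
    exact mul_le_of_le_one_right (norm_nonneg _) h1
  · exact FormalMultilinearSeries.ofScalars_norm_le _ _ _ hn

/-- The matrices `Q` for which `c⁻¹ Q - 1` is a strict contraction of the Euclidean space. -/
def contractionBall (r : ℕ) (c : ℝ) : Set (Mat r) :=
  {Q | ‖Matrix.toEuclideanCLM (n := Fin r) (𝕜 := ℂ) ((c : ℂ)⁻¹ • Q - 1)‖ < 1}

/-- The sum of the binomial series for the power `Q ^ s`, centered at the scalar matrix `c`. -/
noncomputable def binomialPow (c s : ℝ) (Q : Mat r) : Mat r :=
  ((c ^ s : ℝ) : ℂ) • ∑' n : ℕ, Ring.choose (s : ℂ) n • ((c : ℂ)⁻¹ • Q - 1) ^ n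

/-- Matrices as operators on the Euclidean space, as a real continuous linear equivalence. -/
noncomputable def euclideanEquiv (r : ℕ) :
    Mat r ≃L[ℝ] (EuclideanSpace ℂ (Fin r) →L[ℂ] EuclideanSpace ℂ (Fin r)) :=
  (Matrix.toEuclideanCLM (n := Fin r) (𝕜 := ℂ)).toAlgEquiv.toLinearEquiv.restrictScalars ℝ
    |>.toContinuousLinearEquiv

theorem euclideanEquiv_apply (A : Mat r) :
    euclideanEquiv r A = Matrix.toEuclideanCLM (n := Fin r) (𝕜 := ℂ) A := rfl

theorem isOpen_contractionBall (c : ℝ) : IsOpen (contractionBall r c) := by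
  have : Continuous fun Q : Mat r => ‖euclideanEquiv r ((c : ℂ)⁻¹ • Q - 1)‖ :=
    ((euclideanEquiv r).continuous.comp
      ((continuous_id.const_smul (c : ℂ)⁻¹).sub continuous_const)).norm
  exact isOpen_lt this continuous_const

theorem mem_ball_radius {c : ℝ} {Q : Mat r} (hQ : Q ∈ contractionBall r c) (s : ℂ) :
    euclideanEquiv r ((c : ℂ)⁻¹ • Q - 1) ∈ Metric.eball 0
      (binomialSeries (EuclideanSpace ℂ (Fin r) →L[ℂ] EuclideanSpace ℂ (Fin r)) s).radius := by
  refine Metric.eball_subset_eball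
    (one_le_binomialSeries_radius (ContinuousLinearMap.norm_id_le) s) ?_
  rw [← ENNReal.ofReal_one, Metric.eball_ofReal]
  exact mem_ball_zero_iff.2 hQ

theorem contDiffAt_binomialSeries_sum {𝔸 : Type*} [NormedRing 𝔸] [NormedAlgebra ℂ 𝔸]
    [NormedSpace ℝ 𝔸] [IsScalarTower ℝ ℂ 𝔸] [CompleteSpace 𝔸] (h1 : ‖(1 : 𝔸)‖ ≤ 1) (s : ℂ) {x : 𝔸}
    (hx : x ∈ Metric.eball 0 (binomialSeries 𝔸 s).radius) :
    ContDiffAt ℝ ∞ (binomialSeries 𝔸 s).sum x := by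
  have h0 : 0 < (binomialSeries 𝔸 s).radius :=
    lt_of_lt_of_le one_pos (one_le_binomialSeries_radius h1 s)
  have h := ((binomialSeries 𝔸 s).hasFPowerSeriesOnBall h0).analyticAt_of_mem hx
  exact (h.contDiffAt (n := ∞)).restrict_scalars ℝ

/-- The Frobenius norm of the identity is `√r`, so convergence is established in the operator norm
and transported back by the linear homeomorphism `euclideanEquiv`. -/
theorem hasSum_binomialPow_aux {c : ℝ} {Q : Mat r} (hQ : Q ∈ contractionBall r c) (s : ℂ) :
    HasSum (fun n : ℕ => Ring.choose s n • ((c : ℂ)⁻¹ • Q - 1) ^ n)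
      ((euclideanEquiv r).symm
        ((binomialSeries (EuclideanSpace ℂ (Fin r) →L[ℂ] EuclideanSpace ℂ (Fin r)) s).sum
          (euclideanEquiv r ((c : ℂ)⁻¹ • Q - 1)))) := by
  have h := FormalMultilinearSeries.hasSum _ (mem_ball_radius hQ s)
  have h2 := h.mapL (euclideanEquiv r).symm.toContinuousLinearMap
  convert! h2 using 2 with n
  rw [← (euclideanEquiv r).symm_apply_apply (Ring.choose s n • ((c : ℂ)⁻¹ • Q - 1) ^ n)]
  simp [euclideanEquiv_apply, List.ofFn_const]

theorem hasSum_binomialPow {c : ℝ} {Q : Mat r} (hQ : Q ∈ contractionBall r c) (s : ℂ) :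
    HasSum (fun n : ℕ => Ring.choose s n • ((c : ℂ)⁻¹ • Q - 1) ^ n)
      (∑' n : ℕ, Ring.choose s n • ((c : ℂ)⁻¹ • Q - 1) ^ n) :=
  (hasSum_binomialPow_aux hQ s).summable.hasSum

theorem contDiffAt_symm_comp_affine {G : Type*} [NormedAddCommGroup G] [NormedSpace ℝ G]
    (e : Mat r ≃L[ℝ] G) {f : G → G} (z w : ℂ) {Q : Mat r}
    (hf : ContDiffAt ℝ ∞ f (e (z • Q - 1))) :
    ContDiffAt ℝ ∞ (fun Q : Mat r => w • e.symm (f (e (z • Q - 1)))) Q := by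
  have hlin : ContDiffAt ℝ ∞ (fun Q : Mat r => e (z • Q - 1)) Q :=
    e.contDiff.contDiffAt.comp Q ((contDiffAt_id.const_smul z).sub contDiffAt_const)
  exact (e.symm.contDiff.contDiffAt.comp Q (ContDiffAt.comp Q hf hlin)).const_smul w

theorem contDiffAt_binomialPow {c : ℝ} {Q : Mat r} (hQ : Q ∈ contractionBall r c) (s : ℝ) :
    ContDiffAt ℝ ∞ (binomialPow c s) Q := by
  have h := contDiffAt_symm_comp_affine (euclideanEquiv r) (c : ℂ)⁻¹ ((c ^ s : ℝ) : ℂ)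
    (contDiffAt_binomialSeries_sum ContinuousLinearMap.norm_id_le (s : ℂ) (mem_ball_radius hQ s))
  refine h.congr_of_eventuallyEq ?_
  filter_upwards [(isOpen_contractionBall c).mem_nhds hQ] with X hX
  rw [binomialPow, (hasSum_binomialPow_aux hX s).tsum_eq]

theorem conj_pow_eq {S : Mat r} (hS : IsUnit S) (X : Mat r) (n : ℕ) :
    (S * X * S⁻¹) ^ n = S * X ^ n * S⁻¹ := by
  have hdet := (Matrix.isUnit_iff_isUnit_det S).1 hS
  induction n with
  | zero => simp [Matrix.mul_nonsing_inv S hdet]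
  | succ n ih =>
    rw [pow_succ, ih, pow_succ]
    calc S * X ^ n * S⁻¹ * (S * X * S⁻¹) = S * X ^ n * (S⁻¹ * S) * X * S⁻¹ := by noncomm_ring
      _ = _ := by rw [Matrix.nonsing_inv_mul S hdet]; noncomm_ring

theorem binomialPow_conj {c : ℝ} {Q : Mat r} (hQ : Q ∈ contractionBall r c) (s : ℝ)
    {S : Mat r} (hS : IsUnit S) :
    binomialPow c s (S * Q * S⁻¹) = S * binomialPow c s Q * S⁻¹ := by
  have hdet := (Matrix.isUnit_iff_isUnit_det S).1 hS
  have hsub : (c : ℂ)⁻¹ • (S * Q * S⁻¹) - 1 = S * ((c : ℂ)⁻¹ • Q - 1) * S⁻¹ := by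
    rw [mul_sub, sub_mul, mul_one, Matrix.mul_nonsing_inv S hdet, mul_smul_comm, smul_mul_assoc]
  have h := ((hasSum_binomialPow hQ s).mul_left S).mul_right S⁻¹
  rw [binomialPow, binomialPow, hsub, mul_smul_comm, smul_mul_assoc, ← h.tsum_eq]
  simp_rw [conj_pow_eq hS, mul_smul_comm, smul_mul_assoc]

/-- Differentiating this relation is what determines the derivative of the power. -/
theorem binomialPow_commute {c : ℝ} {Q : Mat r} (hQ : Q ∈ contractionBall r c) (s : ℝ) :
    Q * binomialPow c s Q = binomialPow c s Q * Q := by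
  have h1 := (hasSum_binomialPow hQ s).mul_left Q
  have h2 := (hasSum_binomialPow hQ s).mul_right Q
  have hc : ∀ n, Q * ((c : ℂ)⁻¹ • Q - 1) ^ n = ((c : ℂ)⁻¹ • Q - 1) ^ n * Q := fun n =>
    (((Commute.refl Q).smul_right _).sub_right (Commute.one_right Q)).pow_right n
  rw [binomialPow, mul_smul_comm, smul_mul_assoc, ← h1.tsum_eq, ← h2.tsum_eq]
  simp_rw [mul_smul_comm, smul_mul_assoc, hc]

/-- The bounds put `q_i / c - 1` in `(-1, 1)`, where the scalar binomial series sums to `(q_i /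
c)^s`; the prefactor `c^s` removes the scaling. -/
theorem binomialPow_diagonal {c : ℝ} (s : ℝ) {q : Fin r → ℝ} (h0 : ∀ i, 0 < q i)
    (h1 : ∀ i, q i < 2 * c) :
    binomialPow c s (Matrix.diagonal fun i => (q i : ℂ)) =
      Matrix.diagonal fun i => ((q i ^ s : ℝ) : ℂ) := by
  rcases isEmpty_or_nonempty (Fin r) with h | ⟨⟨i₀⟩⟩
  · exact Subsingleton.elim _ _
  have hc : 0 < c := by linarith [h0 i₀, h1 i₀]
  have hsub : (c : ℂ)⁻¹ • (Matrix.diagonal fun i => (q i : ℂ)) - 1 =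
      (Matrix.diagonal fun i => ((c⁻¹ * q i - 1 : ℝ) : ℂ) : Mat r) := by
    rw [← Matrix.diagonal_one, ← Matrix.diagonal_smul, Matrix.diagonal_sub]
    congr 1; ext i; simp
  have hs : ∀ i, HasSum (fun n : ℕ => Ring.choose (s : ℂ) n * ((c⁻¹ * q i - 1 : ℝ) : ℂ) ^ n)
      (((c⁻¹ * q i) ^ s : ℝ) : ℂ) := fun i => by
    have hpos : 0 < c⁻¹ * q i := by have := h0 i; positivity
    have hlt : c⁻¹ * q i < 2 := by
      rw [inv_mul_lt_iff₀ hc]; linarith [h1 i]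
    have := (Complex.one_add_cpow_hasFPowerSeriesOnBall_zero (a := (s : ℂ))).hasSum
      (y := ((c⁻¹ * q i - 1 : ℝ) : ℂ)) (by
        rw [← ENNReal.ofReal_one, Metric.eball_ofReal, mem_ball_zero_iff, Complex.norm_real,
          Real.norm_eq_abs, abs_lt]
        constructor <;> linarith)
    rw [Complex.ofReal_cpow hpos.le]
    convert! this using 2 with n
    · rw [binomialSeries_apply, List.ofFn_const, List.prod_replicate, smul_eq_mul]
    · push_cast; ring
  have hd : HasSum (fun n : ℕ => Ring.choose (s : ℂ) n •
      (Matrix.diagonal fun i => ((c⁻¹ * q i - 1 : ℝ) : ℂ) : Mat r) ^ n)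
      (Matrix.diagonal fun i => (((c⁻¹ * q i) ^ s : ℝ) : ℂ)) := by
    convert! (Pi.hasSum.2 hs).matrix_diagonal using 2 with n
    rw [Matrix.diagonal_pow, ← Matrix.diagonal_smul]
    rfl
  rw [binomialPow, hsub, hd.tsum_eq, ← Matrix.diagonal_smul]
  congr 1
  ext i
  rw [Pi.smul_apply, smul_eq_mul, ← Complex.ofReal_mul, ← Real.mul_rpow hc.le
    (by have := h0 i; positivity), mul_inv_cancel_left₀ hc.ne']

theorem mem_contractionBall_unitary_conj {c : ℝ} {Q V : Mat r}
    (hV : V ∈ Matrix.unitaryGroup (Fin r) ℂ) (hQ : Q ∈ contractionBall r c) :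
    V * Q * Vᴴ ∈ contractionBall r c := by
  have hVV : V * Vᴴ = 1 := Matrix.mem_unitaryGroup_iff.1 hV
  have hsub : (c : ℂ)⁻¹ • (V * Q * Vᴴ) - 1 = V * ((c : ℂ)⁻¹ • Q - 1) * Vᴴ := by
    rw [mul_sub, sub_mul, mul_one, hVV, mul_smul_comm, smul_mul_assoc]
  have hmem : Matrix.toEuclideanCLM (n := Fin r) (𝕜 := ℂ) V ∈
      unitary (EuclideanSpace ℂ (Fin r) →L[ℂ] EuclideanSpace ℂ (Fin r)) :=
    Unitary.map_mem (Matrix.toEuclideanCLM (n := Fin r) (𝕜 := ℂ)) hV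
  rw [contractionBall, Set.mem_ofPred_eq, hsub, map_mul, map_mul, ← Matrix.star_eq_conjTranspose,
    map_star, CStarRing.norm_mul_mem_unitary _ (Unitary.star_mem hmem),
    CStarRing.norm_mem_unitary_mul _ hmem]
  exact hQ

theorem diagonal_mem_contractionBall_iff {c : ℝ} (hc : 0 < c) {q : Fin r → ℝ} :
    Matrix.diagonal (fun i => (q i : ℂ)) ∈ contractionBall r c ↔
      ∀ i, 0 < q i ∧ q i < 2 * c := by
  have hsub : (c : ℂ)⁻¹ • (Matrix.diagonal fun i => (q i : ℂ)) - 1 =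
      (Matrix.diagonal fun i => ((c⁻¹ * q i - 1 : ℝ) : ℂ) : Mat r) := by
    rw [← Matrix.diagonal_one, ← Matrix.diagonal_smul, Matrix.diagonal_sub]
    congr 1; ext i; simp
  have hn := Matrix.l2_opNorm_diagonal (𝕜 := ℂ) (fun i => ((c⁻¹ * q i - 1 : ℝ) : ℂ))
  rw [Matrix.cstar_norm_def] at hn
  rw [contractionBall, Set.mem_ofPred_eq, hsub, hn, pi_norm_lt_iff one_pos]
  refine forall_congr' fun i => ?_
  rw [Complex.norm_real, Real.norm_eq_abs, abs_lt]
  have e : c⁻¹ * q i = q i / c := by ring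
  rw [e, neg_lt_sub_iff_lt_add, sub_lt_iff_lt_add, div_lt_iff₀ hc]
  constructor
  · rintro ⟨h1, h2⟩
    exact ⟨by have := (lt_add_iff_pos_right (1:ℝ)).1 h1; exact (div_pos_iff_of_pos_right hc).1 this,
      by linarith⟩
  · rintro ⟨h1, h2⟩
    exact ⟨by have := div_pos h1 hc; linarith, by linarith⟩

end BinomialPow

/-! ### Polar decomposition, equivariance and smoothness of the transform -/

section Spectral

variable {r : ℕ}

/-- On the finite spectrum `f` agrees with a Lagrange interpolation polynomial, and polynomials
commute with algebra homomorphisms: conjugation by `V`, the diagonal embedding, evaluation at an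
index. -/
theorem cfc_unitary_conj_diagonal (f : ℝ → ℝ) {V : Mat r} (hV : V ∈ Matrix.unitaryGroup (Fin r) ℂ)
    (q : Fin r → ℝ) :
    cfc f (V * Matrix.diagonal (fun i => (q i : ℂ)) * Vᴴ) =
      V * Matrix.diagonal (fun i => (f (q i) : ℂ)) * Vᴴ := by
  set p : Polynomial ℝ := Lagrange.interpolate (Finset.univ.image q) id f
  have hp : ∀ i, p.eval (q i) = f (q i) := fun i =>
    Lagrange.eval_interpolate_at_node f (Set.injOn_id _)
      (Finset.mem_image_of_mem q (Finset.mem_univ i))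
  let φ : Mat r →ₐ[ℝ] Mat r :=
    ((Unitary.conjStarAlgAut ℝ (Mat r) ⟨V, hV⟩ : Mat r ≃⋆ₐ[ℝ] Mat r) : Mat r →⋆ₐ[ℝ] Mat r)
  have hφ : ∀ X, φ X = V * X * Vᴴ := fun X => rfl
  have hsa : IsSelfAdjoint (V * Matrix.diagonal (fun i => (q i : ℂ)) * Vᴴ) := by
    rw [isSelfAdjoint_iff, Matrix.star_eq_conjTranspose, Matrix.conjTranspose_mul,
      Matrix.conjTranspose_mul, Matrix.conjTranspose_conjTranspose, Matrix.diagonal_conjTranspose,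
      Matrix.mul_assoc]
    congr 3
    ext i
    simp
  have hspec : (spectrum ℝ (V * Matrix.diagonal (fun i => (q i : ℂ)) * Vᴴ)).EqOn f
      fun x => p.eval x := by
    intro x hx
    have hx' : (x : ℂ) ∈ spectrum ℂ (V * Matrix.diagonal (fun i => (q i : ℂ)) * Vᴴ) :=
      (spectrum.algebraMap_mem_iff ℂ).2 hx
    have he : spectrum ℂ (V * Matrix.diagonal (fun i => (q i : ℂ)) * Vᴴ) = _ :=
      Unitary.spectrum_star_right_conjugate (U := ⟨V, hV⟩)
    rw [he, spectrum_diagonal] at hx'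
    obtain ⟨i, hi⟩ := hx'
    have : q i = x := Complex.ofReal_injective hi
    rw [← this]
    exact (hp i).symm
  rw [cfc_congr hspec, cfc_polynomial p _ hsa, ← hφ, ← hφ, Polynomial.aeval_algHom_apply]
  congr 1
  change Polynomial.aeval (Matrix.diagonalAlgHom ℝ fun i => (q i : ℂ)) p = _
  rw [Polynomial.aeval_algHom_apply]
  change Matrix.diagonal _ = _
  congr 1
  ext i
  rw [← hp i]
  change Pi.evalAlgHom ℝ (fun _ : Fin r => ℂ) i (Polynomial.aeval (fun i => (q i : ℂ)) p) = _
  rw [← Polynomial.aeval_algHom_apply]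
  exact Polynomial.aeval_algebraMap_apply_eq_algebraMap_eval (A := ℂ) (q i) p

open scoped ComplexOrder in
theorem exists_gram_eq {T : Mat r} (hT : IsUnit T) :
    ∃ V ∈ Matrix.unitaryGroup (Fin r) ℂ, ∃ q : Fin r → ℝ, (∀ i, 0 < q i) ∧
      Tᴴ * T = V * Matrix.diagonal (fun i => (q i : ℂ)) * Vᴴ := by
  have hpos : (Tᴴ * T).PosDef :=
    Matrix.PosDef.conjTranspose_mul_self _ (Matrix.mulVec_injective_iff_isUnit.2 hT)
  exact ⟨hpos.isHermitian.eigenvectorUnitary, SetLike.coe_mem _, hpos.isHermitian.eigenvalues,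
    hpos.eigenvalues_pos, hpos.isHermitian.spectral_theorem⟩

theorem conj_diagonal_mul {V : Mat r} (hV : V ∈ Matrix.unitaryGroup (Fin r) ℂ) (a b : Fin r → ℂ) :
    V * Matrix.diagonal a * Vᴴ * (V * Matrix.diagonal b * Vᴴ) =
      V * Matrix.diagonal (fun i => a i * b i) * Vᴴ := by
  have h : Vᴴ * V = 1 := Matrix.mem_unitaryGroup_iff'.1 hV
  rw [← Matrix.diagonal_mul_diagonal]
  calc _ = V * Matrix.diagonal a * (Vᴴ * V) * Matrix.diagonal b * Vᴴ := by noncomm_ring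
    _ = _ := by rw [h]; noncomm_ring

theorem modulus_eq {T V : Mat r} (hV : V ∈ Matrix.unitaryGroup (Fin r) ℂ) {q : Fin r → ℝ}
    (hq : Tᴴ * T = V * Matrix.diagonal (fun i => (q i : ℂ)) * Vᴴ) :
    modulus T = V * Matrix.diagonal (fun i => (√(q i) : ℂ)) * Vᴴ := by
  rw [modulus, hq, cfc_unitary_conj_diagonal _ hV]

/-- The two factors on the right of `T` merge: `|T|⁻¹ |T|^(1-λ) = |T|^(-λ)`. The eigenvalues of
`|T|` are `√(q i)`, whence the exponents `±λ/2`. -/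
theorem aluthge_eq_conj {T V : Mat r} (hV : V ∈ Matrix.unitaryGroup (Fin r) ℂ) {q : Fin r → ℝ}
    (h0 : ∀ i, 0 < q i) (hq : Tᴴ * T = V * Matrix.diagonal (fun i => (q i : ℂ)) * Vᴴ) (lam : ℝ) :
    aluthge lam T = V * Matrix.diagonal (fun i => ((q i ^ (lam / 2) : ℝ) : ℂ)) * Vᴴ * T *
      (V * Matrix.diagonal (fun i => ((q i ^ (-(lam / 2)) : ℝ) : ℂ)) * Vᴴ) := by
  rw [aluthge, polarFactor, modulusPow, modulusPow, modulus_eq hV hq,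
    cfc_unitary_conj_diagonal _ hV, cfc_unitary_conj_diagonal _ hV, cfc_unitary_conj_diagonal _ hV,
    Matrix.mul_assoc, Matrix.mul_assoc T, conj_diagonal_mul hV, ← Matrix.mul_assoc]
  congr 1
  · congr 5
    ext i
    rw [Real.sqrt_eq_rpow, ← Real.rpow_mul (h0 i).le]
    ring_nf
  · congr 4
    ext i
    rw [← Complex.ofReal_mul, Real.sqrt_eq_rpow, ← Real.rpow_neg_one, ← Real.rpow_mul (h0 i).le,
      ← Real.rpow_mul (h0 i).le, ← Real.rpow_add (h0 i)]
    ring_nf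

theorem binomialPow_conj_diagonal {c : ℝ} (hc : 0 < c) {Q V : Mat r}
    (hV : V ∈ Matrix.unitaryGroup (Fin r) ℂ) {q : Fin r → ℝ}
    (hq : Q = V * Matrix.diagonal (fun i => (q i : ℂ)) * Vᴴ) (hQ : Q ∈ contractionBall r c)
    (s : ℝ) :
    binomialPow c s Q = V * Matrix.diagonal (fun i => ((q i ^ s : ℝ) : ℂ)) * Vᴴ := by
  have h : Vᴴ * V = 1 := Matrix.mem_unitaryGroup_iff'.1 hV
  have h' : V * Vᴴ = 1 := Matrix.mem_unitaryGroup_iff.1 hV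
  have hdiag : Matrix.diagonal (fun i => (q i : ℂ)) ∈ contractionBall r c := by
    have hV' : Vᴴ ∈ Matrix.unitaryGroup (Fin r) ℂ := Unitary.star_mem hV
    have := mem_contractionBall_unitary_conj hV' hQ
    rw [hq, Matrix.conjTranspose_conjTranspose] at this
    convert! this using 1
    calc _ = (Vᴴ * V) * Matrix.diagonal (fun i => (q i : ℂ)) * (Vᴴ * V) := by
          rw [h, one_mul, mul_one]
      _ = _ := by noncomm_ring
  have hi : V⁻¹ = Vᴴ := Matrix.inv_eq_right_inv h'
  have hu : IsUnit V := ⟨⟨V, Vᴴ, h', h⟩, rfl⟩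
  have hb := (diagonal_mem_contractionBall_iff hc).1 hdiag
  rw [hq, ← hi, binomialPow_conj hdiag s hu,
    binomialPow_diagonal s (fun i => (hb i).1) fun i => (hb i).2]

theorem exists_gram_mem_contractionBall {T : Mat r} (hT : IsUnit T) :
    ∃ c : ℝ, 0 < c ∧ Tᴴ * T ∈ contractionBall r c := by
  obtain ⟨V, hV, q, h0, hq⟩ := exists_gram_eq hT
  have hs : ∀ i, q i ≤ ∑ j, q j := fun i =>
    Finset.single_le_sum (fun j _ => (h0 j).le) (Finset.mem_univ i)
  have hs0 : 0 ≤ ∑ j, q j := Finset.sum_nonneg fun j _ => (h0 j).le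
  -- The trace bounds each eigenvalue; the summand `1` keeps the centre positive when `r = 0`.
  refine ⟨1 + ∑ j, q j, by linarith, ?_⟩
  rw [hq]
  refine mem_contractionBall_unitary_conj hV
    ((diagonal_mem_contractionBall_iff (by linarith)).2 fun i => ⟨h0 i, ?_⟩)
  linarith [hs i]

theorem aluthge_eq_binomialPow {c : ℝ} (hc : 0 < c) {T : Mat r} (hT : IsUnit T)
    (hQ : Tᴴ * T ∈ contractionBall r c) (lam : ℝ) :
    aluthge lam T =
      binomialPow c (lam / 2) (Tᴴ * T) * T * binomialPow c (-(lam / 2)) (Tᴴ * T) := by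
  obtain ⟨V, hV, q, h0, hq⟩ := exists_gram_eq hT
  rw [aluthge_eq_conj hV h0 hq, binomialPow_conj_diagonal hc hV hq hQ,
    binomialPow_conj_diagonal hc hV hq hQ]

theorem binomialPow_neg_mul {c : ℝ} (hc : 0 < c) {T : Mat r} (hT : IsUnit T)
    (hQ : Tᴴ * T ∈ contractionBall r c) (s : ℝ) :
    binomialPow c (-s) (Tᴴ * T) * binomialPow c s (Tᴴ * T) = 1 := by
  obtain ⟨V, hV, q, h0, hq⟩ := exists_gram_eq hT
  rw [binomialPow_conj_diagonal hc hV hq hQ, binomialPow_conj_diagonal hc hV hq hQ,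
    conj_diagonal_mul hV]
  have : (fun i => ((q i ^ (-s) : ℝ) : ℂ) * ((q i ^ s : ℝ) : ℂ)) = 1 := by
    ext i
    rw [← Complex.ofReal_mul, ← Real.rpow_add (h0 i)]
    simp
  rw [this, Matrix.diagonal_one', mul_one]
  exact Matrix.mem_unitaryGroup_iff.1 hV

/-- This form has no inverse power, so its derivative involves that of a single power. -/
theorem aluthge_mul_binomialPow {c : ℝ} (hc : 0 < c) {T : Mat r} (hT : IsUnit T)
    (hQ : Tᴴ * T ∈ contractionBall r c) (lam : ℝ) :
    aluthge lam T * binomialPow c (lam / 2) (Tᴴ * T) = binomialPow c (lam / 2) (Tᴴ * T) * T := by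
  rw [aluthge_eq_binomialPow hc hT hQ, Matrix.mul_assoc, binomialPow_neg_mul hc hT hQ, mul_one]

theorem aluthge_unitary_conj {T U : Mat r} (hU : U ∈ Matrix.unitaryGroup (Fin r) ℂ)
    (hT : IsUnit T) (lam : ℝ) :
    aluthge lam (U * T * Uᴴ) = U * aluthge lam T * Uᴴ := by
  have h : Uᴴ * U = 1 := Matrix.mem_unitaryGroup_iff'.1 hU
  obtain ⟨V, hV, q, h0, hq⟩ := exists_gram_eq hT
  have hq' : (U * T * Uᴴ)ᴴ * (U * T * Uᴴ) =
      (U * V) * Matrix.diagonal (fun i => (q i : ℂ)) * (U * V)ᴴ := by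
    rw [Matrix.conjTranspose_mul, Matrix.conjTranspose_mul, Matrix.conjTranspose_conjTranspose,
      Matrix.conjTranspose_mul]
    calc _ = U * (Tᴴ * (Uᴴ * U) * T) * Uᴴ := by noncomm_ring
      _ = _ := by rw [h, mul_one, hq]; noncomm_ring
  rw [aluthge_eq_conj (mul_mem hU hV) h0 hq', aluthge_eq_conj hV h0 hq, Matrix.conjTranspose_mul]
  generalize Matrix.diagonal (fun i => ((q i ^ (lam / 2) : ℝ) : ℂ)) = A
  generalize Matrix.diagonal (fun i => ((q i ^ (-(lam / 2)) : ℝ) : ℂ)) = B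
  calc _ = U * V * A * Vᴴ * (Uᴴ * U) * T * (Uᴴ * U) * V * B * Vᴴ * Uᴴ := by noncomm_ring
    _ = _ := by rw [h]; noncomm_ring

theorem gram_diagonal (d : Fin r → ℂ) :
    (Matrix.diagonal d)ᴴ * Matrix.diagonal d =
      Matrix.diagonal fun i => ((‖d i‖ ^ 2 : ℝ) : ℂ) := by
  rw [Matrix.diagonal_conjTranspose, Matrix.diagonal_mul_diagonal]
  congr 1
  ext i
  rw [Pi.star_apply, RCLike.star_def, mul_comm, Complex.mul_conj']
  norm_cast

theorem aluthge_diagonal {d : Fin r → ℂ} (hd : ∀ i, d i ≠ 0) (lam : ℝ) :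
    aluthge lam (Matrix.diagonal d) = Matrix.diagonal d := by
  have h0 : ∀ i, 0 < ‖d i‖ ^ 2 := fun i => by have := norm_pos_iff.2 (hd i); positivity
  rw [aluthge_eq_conj (V := 1) (one_mem _) h0 (by rw [gram_diagonal]; simp)]
  rw [Matrix.conjTranspose_one, one_mul, mul_one, one_mul, mul_one, Matrix.diagonal_mul_diagonal,
    Matrix.diagonal_mul_diagonal]
  congr 1
  ext i
  rw [mul_right_comm, ← Complex.ofReal_mul, ← Real.rpow_add (h0 i)]
  simp

theorem isUnit_diagonal {d : Fin r → ℂ} (hd : ∀ i, d i ≠ 0) : IsUnit (Matrix.diagonal d) :=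
  Matrix.isUnit_diagonal.2 (Pi.isUnit_iff.2 fun i => (hd i).isUnit)

theorem isUnit_of_mem_similarityOrbit {D T : Mat r} (hD : IsUnit D)
    (hT : T ∈ similarityOrbit D) : IsUnit T := by
  obtain ⟨S, hS, rfl⟩ := hT
  exact (hS.mul hD).mul ((Matrix.isUnit_nonsing_inv_iff).2 hS)

theorem mapsTo_aluthge {D : Mat r} (hD : IsUnit D) (lam : ℝ) :
    Set.MapsTo (aluthge lam) (similarityOrbit D) (similarityOrbit D) := by
  intro T hT
  have hTu := isUnit_of_mem_similarityOrbit hD hT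
  obtain ⟨c, hc, hQ⟩ := exists_gram_mem_contractionBall hTu
  have h1 := binomialPow_neg_mul hc hTu hQ (lam / 2)
  have h2 : binomialPow c (lam / 2) (Tᴴ * T) * binomialPow c (-(lam / 2)) (Tᴴ * T) = 1 := by
    simpa using binomialPow_neg_mul hc hTu hQ (-(lam / 2))
  rw [aluthge_eq_binomialPow hc hTu hQ]
  obtain ⟨S, hS, rfl⟩ := hT
  have hu : IsUnit (binomialPow c (lam / 2) ((S * D * S⁻¹)ᴴ * (S * D * S⁻¹))) :=
    ⟨⟨_, _, h2, h1⟩, rfl⟩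
  refine ⟨_, hu.mul hS, ?_⟩
  rw [Matrix.mul_inv_rev, Matrix.inv_eq_right_inv h2]
  noncomm_ring

section
attribute [local instance] Matrix.frobeniusNormedRing Matrix.frobeniusNormedAlgebra

/-- The conjugate transpose as a real continuous linear map. -/
noncomputable def conjTransposeCLM (r : ℕ) : Mat r →L[ℝ] Mat r :=
  LinearMap.toContinuousLinearMap
    { toFun := fun X => Xᴴ
      map_add' := Matrix.conjTranspose_add
      map_smul' := fun t X => by simp [Matrix.conjTranspose_smul] }

theorem contDiff_gram : ContDiff ℝ ∞ fun T : Mat r => Tᴴ * T :=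
  (conjTransposeCLM r).contDiff.mul contDiff_id

theorem eventually_isUnit {T : Mat r} (hT : IsUnit T) : ∀ᶠ X in 𝓝 T, IsUnit X :=
  Units.isOpen.mem_nhds hT

/-- One centre `c` serves a whole neighbourhood of `T`, because the contraction ball is open. -/
theorem contDiffAt_aluthge {T : Mat r} (hT : IsUnit T) (lam : ℝ) :
    ContDiffAt ℝ ∞ (aluthge lam) T := by
  obtain ⟨c, hc, hQ⟩ := exists_gram_mem_contractionBall hT
  have hg : ContDiffAt ℝ ∞ (fun X : Mat r => Xᴴ * X) T := contDiff_gram.contDiffAt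
  have hF : ∀ s : ℝ, ContDiffAt ℝ ∞ (fun X : Mat r => binomialPow c s (Xᴴ * X)) T := fun s =>
    ContDiffAt.comp (g := binomialPow c s) (f := fun X : Mat r => Xᴴ * X) T
      (contDiffAt_binomialPow hQ s) hg
  have h : ContDiffAt ℝ ∞ (fun T : Mat r => binomialPow c (lam / 2) (Tᴴ * T) * T *
      binomialPow c (-(lam / 2)) (Tᴴ * T)) T :=
    ((hF (lam / 2)).mul contDiffAt_id).mul (hF (-(lam / 2)))
  refine h.congr_of_eventuallyEq ?_
  filter_upwards [eventually_isUnit hT,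
    hg.continuousAt.preimage_mem_nhds ((isOpen_contractionBall c).mem_nhds hQ)] with X hX hXQ
  exact aluthge_eq_binomialPow hc hX hXQ lam

end

end Spectral

/-! ### The constant `k` and the eigenvalues of the derivative -/

section ContractionConst

variable {r : ℕ}

theorem iSup_lt_of_finite {ι : Type*} [Finite ι] {f : ι → ℝ} {b : ℝ} (hb : 0 < b)
    (h : ∀ i, f i < b) : ⨆ i, f i < b := by
  rcases isEmpty_or_nonempty ι with hι | hι
  · rwa [Real.iSup_of_isEmpty]
  · obtain ⟨i, hi⟩ := exists_eq_ciSup_of_finite (f := f)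
    rw [← hi]
    exact h i

theorem rpow_mix_lt {a b lam : ℝ} (ha : 0 < a) (hb : 0 < b) (hab : a ≠ b) (h0 : 0 < lam)
    (h1 : lam < 1) :
    (b ^ (1 - lam) * a ^ lam + a ^ (1 - lam) * b ^ lam) / (a + b) < 1 := by
  rw [div_lt_one (by positivity)]
  have e : ∀ x : ℝ, 0 < x → x ^ lam * x ^ (1 - lam) = x := fun x hx => by
    rw [← Real.rpow_add hx]; simp
  -- Expanded, this product is `a + b` minus the numerator.
  have key : 0 < (a ^ lam - b ^ lam) * (a ^ (1 - lam) - b ^ (1 - lam)) := by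
    rcases lt_or_gt_of_ne hab with h | h
    · exact mul_pos_of_neg_of_neg (sub_neg.2 (Real.rpow_lt_rpow ha.le h h0))
        (sub_neg.2 (Real.rpow_lt_rpow ha.le h (sub_pos.2 h1)))
    · exact mul_pos (sub_pos.2 (Real.rpow_lt_rpow hb.le h h0))
        (sub_pos.2 (Real.rpow_lt_rpow hb.le h (sub_pos.2 h1)))
  linarith [e a ha, e b hb]

/-- The number is the convex combination `λ e^{iθ} + (1 - λ)` of two distinct points of the unit
circle, and the disc is strictly convex. -/
theorem norm_convex_exp_lt {θ lam : ℝ} (hθ : Complex.exp (Complex.I * (θ : ℂ)) ≠ 1)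
    (h0 : 0 < lam) (h1 : lam < 1) :
    ‖(lam : ℂ) * (Complex.exp (Complex.I * (θ : ℂ)) - 1) + 1‖ < 1 := by
  have hn : ‖Complex.exp (Complex.I * (θ : ℂ))‖ = 1 := by
    rw [mul_comm]; exact Complex.norm_exp_ofReal_mul_I θ
  have h := (strictConvex_closedBall ℝ (0 : ℂ) 1) (x := Complex.exp (Complex.I * (θ : ℂ)))
    (by simp [hn]) (y := 1) (by simp) hθ h0 (sub_pos.2 h1) (by ring)
  rw [interior_closedBall _ one_ne_zero, mem_ball_zero_iff] at h
  convert! h using 2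
  simp only [Complex.real_smul]
  push_cast
  ring

theorem contractionConst_lt_one {d : Fin r → ℂ} (hd : ∀ i, d i ≠ 0) {lam : ℝ} (h0 : 0 < lam)
    (h1 : lam < 1) : contractionConst d lam < 1 := by
  refine max_lt (iSup_lt_of_finite one_pos ?_) (iSup_lt_of_finite one_pos ?_)
  · rintro ⟨⟨i, j⟩, hij⟩
    exact rpow_mix_lt (norm_pos_iff.2 (hd i)) (norm_pos_iff.2 (hd j)) hij h0 h1
  · rintro ⟨⟨i, j⟩, hij⟩
    refine norm_convex_exp_lt (fun h => hij ?_) h0 h1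
    obtain ⟨n, hn⟩ := Complex.exp_eq_one_iff.1 h
    have hn' : (d j).arg - (d i).arg = n * (2 * Real.pi) := by
      have := congrArg Complex.im hn
      simpa using this
    have hi := Complex.neg_pi_lt_arg (d i)
    have hi' := Complex.arg_le_pi (d i)
    have hj := Complex.neg_pi_lt_arg (d j)
    have hj' := Complex.arg_le_pi (d j)
    have hpi := Real.pi_pos
    -- Two arguments in `(-π, π]` differ by less than `2π`.
    have n1 : (n : ℝ) < 1 := by nlinarith
    have n2 : (-1 : ℝ) < n := by nlinarith
    have : n = 0 := by
      have a1 : n < 1 := by exact_mod_cast n1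
      have a2 : -1 < n := by exact_mod_cast n2
      omega
    rw [this] at hn'
    simp only [Int.cast_zero, zero_mul] at hn'
    change (d i).arg = (d j).arg
    linarith

/-- The divided difference of `x ↦ x ^ s` at `a` and `b`. -/
noncomputable def rpowDiv (s a b : ℝ) : ℝ :=
  if a = b then s * a ^ (s - 1) else (a ^ s - b ^ s) / (a - b)

theorem rpowDiv_comm (s a b : ℝ) : rpowDiv s a b = rpowDiv s b a := by
  rcases eq_or_ne a b with rfl | h
  · rfl
  · rw [rpowDiv, rpowDiv, if_neg h, if_neg h.symm, ← neg_sub, ← neg_sub b a, neg_div_neg_eq]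

theorem rpowDiv_mul_sub (s a b : ℝ) : rpowDiv s a b * (a - b) = a ^ s - b ^ s := by
  rcases eq_or_ne a b with rfl | h
  · simp
  · rw [rpowDiv, if_neg h, div_mul_cancel₀ _ (sub_ne_zero.2 h)]

/-- The coefficients of the derivative of the Aluthge transform at `diagonal d`. -/
noncomputable def aluthgeCoeff (d : Fin r → ℂ) (lam : ℝ) (i j : Fin r) : ℂ :=
  -((rpowDiv (lam / 2) (‖d i‖ ^ 2) (‖d j‖ ^ 2) * ‖d j‖ ^ (-lam) : ℝ) : ℂ) *
    (((‖d j‖ ^ 2 : ℝ) : ℂ) - star (d i) * d j)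

/-- The eigenvalues, minus one, of the derivative of the Aluthge transform at `diagonal d`. -/
noncomputable def aluthgeEig (d : Fin r → ℂ) (lam : ℝ) (i j : Fin r) : ℂ :=
  aluthgeCoeff d lam i j + star (aluthgeCoeff d lam j i)

theorem star_aluthgeEig (d : Fin r → ℂ) (lam : ℝ) (i j : Fin r) :
    star (aluthgeEig d lam i j) = aluthgeEig d lam j i := by
  rw [aluthgeEig, aluthgeEig, star_add, star_star, add_comm]

theorem aluthgeEig_eq (d : Fin r → ℂ) (lam : ℝ) (i j : Fin r) :
    aluthgeEig d lam i j = -((rpowDiv (lam / 2) (‖d i‖ ^ 2) (‖d j‖ ^ 2) : ℝ) : ℂ) *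
      (((‖d j‖ ^ (-lam) : ℝ) : ℂ) * (((‖d j‖ ^ 2 : ℝ) : ℂ) - star (d i) * d j) +
        ((‖d i‖ ^ (-lam) : ℝ) : ℂ) * (((‖d i‖ ^ 2 : ℝ) : ℂ) - star (d i) * d j)) := by
  rw [aluthgeEig, aluthgeCoeff, aluthgeCoeff, rpowDiv_comm _ (‖d j‖ ^ 2)]
  simp only [star_mul', star_neg, star_sub, RCLike.star_def, Complex.conj_ofReal,
    Complex.conj_conj]
  push_cast
  ring

theorem star_mul_eq_exp (z w : ℂ) :
    star z * w = ((‖z‖ * ‖w‖ : ℝ) : ℂ) * Complex.exp (Complex.I * ((w.arg - z.arg : ℝ) : ℂ)) := by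
  have hz : star z = (‖z‖ : ℂ) * Complex.exp (-(z.arg : ℂ) * Complex.I) := by
    conv_lhs => rw [← Complex.norm_mul_exp_arg_mul_I z]
    rw [RCLike.star_def, map_mul, Complex.conj_ofReal, ← Complex.exp_conj]
    simp
  rw [hz]
  conv_lhs => rw [← Complex.norm_mul_exp_arg_mul_I w]
  rw [mul_mul_mul_comm, ← Complex.exp_add]
  push_cast
  ring_nf

theorem one_add_aluthgeEig_of_norm_eq {d : Fin r → ℂ} (hd : ∀ i, d i ≠ 0) (lam : ℝ) {i j : Fin r}
    (h : ‖d i‖ = ‖d j‖) :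
    1 + aluthgeEig d lam i j = (lam : ℂ) *
      (Complex.exp (Complex.I * (((d j).arg - (d i).arg : ℝ) : ℂ)) - 1) + 1 := by
  have ha : 0 < ‖d j‖ := norm_pos_iff.2 (hd j)
  rw [aluthgeEig_eq, star_mul_eq_exp, h, rpowDiv, if_pos rfl]
  generalize ‖d j‖ = a at ha
  generalize Complex.exp _ = e
  have e1 : lam / 2 * (a ^ 2) ^ (lam / 2 - 1) * a ^ (-lam) * a ^ 2 = lam / 2 := by
    rw [← Real.rpow_natCast a 2, ← Real.rpow_mul ha.le, mul_assoc, mul_assoc, ← Real.rpow_add ha,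
      ← Real.rpow_add ha]
    ring_nf
    simp
  have e2 : ((lam / 2 * (a ^ 2) ^ (lam / 2 - 1) : ℝ) : ℂ) * ((a ^ (-lam) : ℝ) : ℂ) *
      ((a ^ 2 : ℝ) : ℂ) = (lam : ℂ) / 2 := by
    rw [← Complex.ofReal_mul, ← Complex.ofReal_mul, e1]; push_cast; rfl
  have e3 : ((a * a : ℝ) : ℂ) = ((a ^ 2 : ℝ) : ℂ) := by push_cast; ring
  rw [e3]
  linear_combination (2 * e - 2) * e2

/-- Here `p, P` stand for `|d_i|^λ, |d_i|^(1-λ)` and `q, Q` for the same powers of `|d_j|`, so the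
moduli are `pP` and `qQ`. The left side is what the triangle inequality gives for `1 + μ_ij`; it
equals the quotient in `k` exactly. -/
theorem rpow_mix_identity {p q P Q : ℝ} (hp : 0 < p) (hq : 0 < q) (hP : 0 < P) (hQ : 0 < Q)
    (hne : p * P ≠ q * Q) :
    p * q * (P ^ 2 - Q ^ 2) / ((p * P) ^ 2 - (q * Q) ^ 2) +
      (p - q) / ((p * P) ^ 2 - (q * Q) ^ 2) * ((p * P) * (q * Q)) * (q⁻¹ + p⁻¹) =
    (Q * p + P * q) / (p * P + q * Q) := by
  have h1 : p * P - q * Q ≠ 0 := sub_ne_zero.2 hne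
  have h2 : p * P + q * Q ≠ 0 := by positivity
  obtain ⟨t, ht⟩ : ∃ t, t = (p * P) ^ 2 - (q * Q) ^ 2 := ⟨_, rfl⟩
  have ht0 : t ≠ 0 := by rw [ht, sq_sub_sq]; exact mul_ne_zero h2 h1
  rw [← ht]
  field_simp
  rw [ht]
  ring

/-- With `z = conj(d_i) d_j`, of modulus `|d_i||d_j|`, one has `1 + μ_ij = α + βz`, where `α, β ≥ 0`
by monotonicity of positive powers. The triangle inequality then suffices. -/
theorem norm_one_add_aluthgeEig_le_of_norm_ne {d : Fin r → ℂ} (hd : ∀ i, d i ≠ 0) {lam : ℝ}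
    (h0 : 0 < lam) (h1 : lam < 1) {i j : Fin r} (h : ‖d i‖ ≠ ‖d j‖) :
    ‖1 + aluthgeEig d lam i j‖ ≤
      (‖d j‖ ^ (1 - lam) * ‖d i‖ ^ lam + ‖d i‖ ^ (1 - lam) * ‖d j‖ ^ lam) /
        (‖d i‖ + ‖d j‖) := by
  have hz : ‖star (d i) * d j‖ = ‖d i‖ * ‖d j‖ := by rw [norm_mul, norm_star]
  rw [aluthgeEig_eq]
  have ha : 0 < ‖d i‖ := norm_pos_iff.2 (hd i)
  have hb : 0 < ‖d j‖ := norm_pos_iff.2 (hd j)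
  generalize star (d i) * d j = z at hz
  generalize ‖d i‖ = a at *
  generalize ‖d j‖ = b at *
  have hsq : a ^ 2 ≠ b ^ 2 := fun e => h ((sq_eq_sq₀ ha.le hb.le).1 e)
  have e : ∀ x : ℝ, 0 < x → x ^ lam * x ^ (1 - lam) = x := fun x hx => by
    rw [← Real.rpow_add hx]; simp
  have es : ∀ x : ℝ, 0 < x → (x ^ 2) ^ (lam / 2) = x ^ lam := fun x hx => by
    rw [← Real.rpow_natCast x 2, ← Real.rpow_mul hx.le]
    congr 1
    push_cast
    ring
  rw [rpowDiv, if_neg hsq, es a ha, es b hb, Real.rpow_neg ha.le, Real.rpow_neg hb.le]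
  have s1 : 0 ≤ (a ^ lam - b ^ lam) / (a ^ 2 - b ^ 2) := by
    rcases lt_or_gt_of_ne h with hl | hl
    · exact div_nonneg_of_nonpos (sub_nonpos.2 (Real.rpow_le_rpow ha.le hl.le h0.le))
        (sub_nonpos.2 (pow_le_pow_left₀ ha.le hl.le 2))
    · exact div_nonneg (sub_nonneg.2 (Real.rpow_le_rpow hb.le hl.le h0.le))
        (sub_nonneg.2 (pow_le_pow_left₀ hb.le hl.le 2))
  have s2 : 0 ≤ ((a ^ (1 - lam)) ^ 2 - (b ^ (1 - lam)) ^ 2) / (a ^ 2 - b ^ 2) := by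
    have h1' : 0 ≤ 1 - lam := (sub_pos.2 h1).le
    rcases lt_or_gt_of_ne h with hl | hl
    · exact div_nonneg_of_nonpos (sub_nonpos.2 (pow_le_pow_left₀ (by positivity)
        (Real.rpow_le_rpow ha.le hl.le h1') 2)) (sub_nonpos.2 (pow_le_pow_left₀ ha.le hl.le 2))
    · exact div_nonneg (sub_nonneg.2 (pow_le_pow_left₀ (by positivity)
        (Real.rpow_le_rpow hb.le hl.le h1') 2)) (sub_nonneg.2 (pow_le_pow_left₀ hb.le hl.le 2))
  have hp : 0 < a ^ lam := by positivity
  have hq : 0 < b ^ lam := by positivity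
  have hP : 0 < a ^ (1 - lam) := by positivity
  have hQ : 0 < b ^ (1 - lam) := by positivity
  have ea := e a ha
  have eb := e b hb
  generalize a ^ lam = p at *
  generalize b ^ lam = q at *
  generalize a ^ (1 - lam) = P at *
  generalize b ^ (1 - lam) = Q at *
  subst ea eb
  have hid := rpow_mix_identity hp hq hP hQ h
  have hden : (p * P) ^ 2 - (q * Q) ^ 2 ≠ 0 := sub_ne_zero.2 hsq
  have hre : p * q * (P ^ 2 - Q ^ 2) / ((p * P) ^ 2 - (q * Q) ^ 2) =
      1 - (p - q) / ((p * P) ^ 2 - (q * Q) ^ 2) * (q⁻¹ * (q * Q) ^ 2 + p⁻¹ * (p * P) ^ 2) := by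
    obtain ⟨t, ht⟩ : ∃ t, t = (p * P) ^ 2 - (q * Q) ^ 2 := ⟨_, rfl⟩
    rw [← ht] at hden ⊢
    field_simp
    rw [ht]
    ring
  have hsplit : 1 + -(((p - q) / ((p * P) ^ 2 - (q * Q) ^ 2) : ℝ) : ℂ) *
      (((q⁻¹ : ℝ) : ℂ) * ((((q * Q) ^ 2 : ℝ) : ℂ) - z) +
        ((p⁻¹ : ℝ) : ℂ) * ((((p * P) ^ 2 : ℝ) : ℂ) - z)) =
      ((p * q * (P ^ 2 - Q ^ 2) / ((p * P) ^ 2 - (q * Q) ^ 2) : ℝ) : ℂ) +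
      (((p - q) / ((p * P) ^ 2 - (q * Q) ^ 2) * (q⁻¹ + p⁻¹) : ℝ) : ℂ) * z := by
    rw [hre]
    push_cast
    ring
  rw [hsplit, ← hid]
  refine (norm_add_le _ _).trans (add_le_add ?_ ?_)
  · rw [Complex.norm_real, Real.norm_of_nonneg]
    rw [mul_div_assoc]
    positivity
  · rw [norm_mul, Complex.norm_real, hz, Real.norm_of_nonneg (by positivity)]
    apply le_of_eq
    ring

theorem norm_one_add_aluthgeEig_le {d : Fin r → ℂ} (hd : ∀ i, d i ≠ 0) {lam : ℝ}
    (h0 : 0 < lam) (h1 : lam < 1) {i j : Fin r} (h : d i ≠ d j) :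
    ‖1 + aluthgeEig d lam i j‖ ≤ contractionConst d lam := by
  by_cases hn : ‖d i‖ = ‖d j‖
  · have harg : (d i).arg ≠ (d j).arg := fun e => h (Complex.ext_norm_arg hn e)
    rw [one_add_aluthgeEig_of_norm_eq hd lam hn]
    exact (le_ciSup (f := fun p : {p : Fin r × Fin r // (d p.1).arg ≠ (d p.2).arg} =>
      ‖(lam : ℂ) * (Complex.exp (Complex.I * (((d p.1.2).arg - (d p.1.1).arg : ℝ) : ℂ)) - 1) + 1‖)
      (Set.finite_range _).bddAbove ⟨(i, j), harg⟩).trans (le_max_right _ _)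
  · refine (norm_one_add_aluthgeEig_le_of_norm_ne hd h0 h1 hn).trans ?_
    exact (le_ciSup (f := fun p : {p : Fin r × Fin r // ‖d p.1‖ ≠ ‖d p.2‖} =>
      (‖d p.1.2‖ ^ (1 - lam) * ‖d p.1.1‖ ^ lam + ‖d p.1.1‖ ^ (1 - lam) * ‖d p.1.2‖ ^ lam) /
        (‖d p.1.1‖ + ‖d p.1.2‖))
      (Set.finite_range _).bddAbove ⟨(i, j), hn⟩).trans (le_max_left _ _)

theorem aluthgeEig_ne_zero {d : Fin r → ℂ} (hd : ∀ i, d i ≠ 0) {lam : ℝ}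
    (h0 : 0 < lam) (h1 : lam < 1) {i j : Fin r} (h : d i ≠ d j) :
    aluthgeEig d lam i j ≠ 0 := fun e => by
  have := (norm_one_add_aluthgeEig_le hd h0 h1 h).trans_lt (contractionConst_lt_one hd h0 h1)
  simp [e] at this

end ContractionConst

/-! ### The derivative at a diagonal matrix -/

section Derivative

attribute [local instance] Matrix.frobeniusNormedRing Matrix.frobeniusNormedAlgebra

variable {r : ℕ}

theorem hasDerivAt_line (X Y : Mat r) : HasDerivAt (fun t : ℝ => X + t • Y) Y 0 := by
  have h := ((hasDerivAt_id (0 : ℝ)).smul_const Y).const_add X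
  rw [one_smul] at h
  exact h

theorem fderiv_binomialPow_commute {c s : ℝ} {Q : Mat r} (hQ : Q ∈ contractionBall r c)
    (Y : Mat r) :
    Y * binomialPow c s Q + Q * fderiv ℝ (binomialPow c s) Q Y =
      fderiv ℝ (binomialPow c s) Q Y * Q + binomialPow c s Q * Y := by
  have hl := hasDerivAt_line Q Y
  have hl0 : Q + (0 : ℝ) • Y = Q := by simp
  have hF : HasFDerivAt (binomialPow c s) (fderiv ℝ (binomialPow c s) Q) (Q + (0 : ℝ) • Y) := by
    rw [hl0]
    exact ((contDiffAt_binomialPow hQ s).differentiableAt (by simp)).hasFDerivAt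
  have hc := hF.comp_hasDerivAt 0 hl
  have h1 := hl.mul hc
  have h2 := hc.mul hl
  have he : (fun t : ℝ => Q + t • Y) * (binomialPow c s ∘ fun t : ℝ => Q + t • Y) =ᶠ[𝓝 0]
      (binomialPow c s ∘ fun t : ℝ => Q + t • Y) * (fun t : ℝ => Q + t • Y) := by
    have : Filter.Tendsto (fun t : ℝ => Q + t • Y) (𝓝 0) (𝓝 Q) := by
      simpa using! hl.continuousAt.tendsto
    filter_upwards [this ((isOpen_contractionBall c).mem_nhds hQ)] with t ht
    exact binomialPow_commute ht s
  have := h1.unique (h2.congr_of_eventuallyEq he)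
  simpa using! this

theorem fderiv_binomialPow_diagonal_mul {c s : ℝ} (hc : 0 < c) {q : Fin r → ℝ}
    (h : ∀ i, 0 < q i ∧ q i < 2 * c) (Y : Mat r) (i j : Fin r) :
    fderiv ℝ (binomialPow c s) (Matrix.diagonal fun i => (q i : ℂ)) Y i j * ((q i - q j : ℝ) : ℂ) =
      ((q i ^ s - q j ^ s : ℝ) : ℂ) * Y i j := by
  have h1 := fderiv_binomialPow_commute (s := s) ((diagonal_mem_contractionBall_iff hc).2 h) Y
  rw [binomialPow_diagonal s (fun i => (h i).1) fun i => (h i).2] at h1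
  have h2 := congrFun (congrFun h1 i) j
  simp only [Matrix.add_apply, Matrix.mul_diagonal, Matrix.diagonal_mul] at h2
  push_cast
  linear_combination h2

/-- If `q_i ≠ q_j`, divide the differentiated commutation relation by `q_i - q_j`. If they are
equal, that relation says nothing: shift the `i`-th eigenvalue by `ε`, which separates the two as `i
≠ j`, and let `ε → 0` using continuity of the derivative. -/
theorem fderiv_binomialPow_diagonal {c s : ℝ} (hc : 0 < c) {q : Fin r → ℝ}
    (h : ∀ i, 0 < q i ∧ q i < 2 * c) (Y : Mat r) {i j : Fin r} (hij : i ≠ j) :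
    fderiv ℝ (binomialPow c s) (Matrix.diagonal fun i => (q i : ℂ)) Y i j =
      (rpowDiv s (q i) (q j) : ℂ) * Y i j := by
  by_cases hq : q i = q j
  · rw [rpowDiv, if_pos hq]
    have hmem := (diagonal_mem_contractionBall_iff hc).2 h
    let Z : ℝ → Mat r := fun ε => Matrix.diagonal (fun k => (q k : ℂ)) + ε • Matrix.single i i 1
    have hZ : ∀ ε, Z ε = Matrix.diagonal fun k => ((q k + (if k = i then ε else 0) : ℝ) : ℂ) := by
      intro ε
      ext k l
      by_cases hkl : k = l
      · subst hkl
        by_cases hk : k = i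
        · subst hk; simp [Z]
        · simp [Z, hk, Ne.symm hk]
      · simp only [Z, Matrix.add_apply, Matrix.diagonal_apply_ne _ hkl, Matrix.smul_apply]
        rw [Matrix.single_apply_of_ne _ _ _ _ _ (by rintro ⟨rfl, rfl⟩; exact hkl rfl)]
        simp
    have hZ0 : Z 0 = Matrix.diagonal fun k => (q k : ℂ) := by simp [Z]
    have hZc : ContinuousAt Z 0 := (hasDerivAt_line _ _).continuousAt
    have hcont : ContinuousAt (fun ε => fderiv ℝ (binomialPow c s) (Z ε) Y i j) 0 := by
      have h1 : ContinuousAt (fderiv ℝ (binomialPow c s)) (Z 0) := by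
        rw [hZ0]
        exact ((contDiffAt_binomialPow hmem s).fderiv_right (m := 0) (by simp)).continuousAt
      have h2 : ContinuousAt (fun ε => fderiv ℝ (binomialPow c s) (Z ε) Y) 0 :=
        (ContinuousAt.comp (f := Z) h1 hZc).clm_apply continuousAt_const
      exact ((continuous_apply j).comp (continuous_apply i)).continuousAt.comp h2
    have hslope : Filter.Tendsto (fun ε : ℝ => ((ε⁻¹ * ((q i + ε) ^ s - q i ^ s) : ℝ) : ℂ) * Y i j)
        (𝓝[≠] 0) (𝓝 (((s * q i ^ (s - 1) : ℝ) : ℂ) * Y i j)) := by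
      have := (Real.hasDerivAt_rpow_const (x := q i) (p := s) (Or.inl (h i).1.ne')).tendsto_slope_zero
      exact ((Complex.continuous_ofReal.tendsto _).comp this).mul_const _
    have heq : (fun ε => fderiv ℝ (binomialPow c s) (Z ε) Y i j) =ᶠ[𝓝[≠] 0]
        fun ε : ℝ => ((ε⁻¹ * ((q i + ε) ^ s - q i ^ s) : ℝ) : ℂ) * Y i j := by
      have hev : ∀ᶠ ε in 𝓝 (0 : ℝ), Z ε ∈ contractionBall r c := by
        refine hZc.preimage_mem_nhds ((isOpen_contractionBall c).mem_nhds ?_)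
        rw [hZ0]
        exact hmem
      filter_upwards [hev.filter_mono nhdsWithin_le_nhds, self_mem_nhdsWithin] with ε hε hne
      have hne' : (ε : ℂ) ≠ 0 := Complex.ofReal_ne_zero.2 hne
      rw [hZ] at hε ⊢
      have := fderiv_binomialPow_diagonal_mul (s := s) hc
        ((diagonal_mem_contractionBall_iff hc).1 hε) Y i j
      rw [if_pos rfl, if_neg hij.symm, add_zero, ← hq, add_sub_cancel_left] at this
      rw [Complex.ofReal_mul, mul_assoc, ← this, Complex.ofReal_inv]
      field_simp
    have := tendsto_nhds_unique (hcont.tendsto.mono_left nhdsWithin_le_nhds)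
      (hslope.congr' heq.symm)
    rwa [hZ0] at this
  · have h1 := fderiv_binomialPow_diagonal_mul (s := s) hc h Y i j
    rw [← rpowDiv_mul_sub, Complex.ofReal_mul, mul_right_comm] at h1
    exact mul_right_cancel₀ (Complex.ofReal_ne_zero.2 (sub_ne_zero.2 hq)) h1

theorem fderiv_aluthge_mul {c lam : ℝ} (hc : 0 < c) {T : Mat r} (hT : IsUnit T)
    (hQ : Tᴴ * T ∈ contractionBall r c) (Y : Mat r) :
    fderiv ℝ (aluthge lam) T Y * binomialPow c (lam / 2) (Tᴴ * T) +
        aluthge lam T * fderiv ℝ (binomialPow c (lam / 2)) (Tᴴ * T) (Yᴴ * T + Tᴴ * Y) =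
      fderiv ℝ (binomialPow c (lam / 2)) (Tᴴ * T) (Yᴴ * T + Tᴴ * Y) * T +
        binomialPow c (lam / 2) (Tᴴ * T) * Y := by
  have hl := hasDerivAt_line T Y
  have hl0 : T + (0 : ℝ) • Y = T := by simp
  have hg : HasDerivAt (fun t : ℝ => (T + t • Y)ᴴ * (T + t • Y)) (Yᴴ * T + Tᴴ * Y) 0 := by
    have hs : HasDerivAt (fun t : ℝ => (T + t • Y)ᴴ) Yᴴ 0 :=
      (conjTransposeCLM r).hasFDerivAt.comp_hasDerivAt 0 hl
    simpa using! hs.mul hl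
  have hA : HasFDerivAt (aluthge lam) (fderiv ℝ (aluthge lam) T) (T + (0 : ℝ) • Y) := by
    rw [hl0]
    exact ((contDiffAt_aluthge hT lam).differentiableAt (by simp)).hasFDerivAt
  have hF : HasFDerivAt (binomialPow c (lam / 2)) (fderiv ℝ (binomialPow c (lam / 2)) (Tᴴ * T))
      ((T + (0 : ℝ) • Y)ᴴ * (T + (0 : ℝ) • Y)) := by
    rw [hl0]
    exact ((contDiffAt_binomialPow hQ _).differentiableAt (by simp)).hasFDerivAt
  have hA' := hA.comp_hasDerivAt 0 hl
  have hF' := HasFDerivAt.comp_hasDerivAt (f := fun t : ℝ => (T + t • Y)ᴴ * (T + t • Y)) 0 hF hg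
  have he : (fun t : ℝ => aluthge lam (T + t • Y)) *
        (fun t : ℝ => binomialPow c (lam / 2) ((T + t • Y)ᴴ * (T + t • Y))) =ᶠ[𝓝 0]
      (fun t : ℝ => binomialPow c (lam / 2) ((T + t • Y)ᴴ * (T + t • Y))) *
        (fun t : ℝ => T + t • Y) := by
    have h1 : Filter.Tendsto (fun t : ℝ => T + t • Y) (𝓝 0) (𝓝 T) := by
      simpa using! hl.continuousAt.tendsto
    have h2 : Filter.Tendsto (fun t : ℝ => (T + t • Y)ᴴ * (T + t • Y)) (𝓝 0) (𝓝 (Tᴴ * T)) := by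
      simpa using! hg.continuousAt.tendsto
    filter_upwards [h1 (eventually_isUnit hT),
      h2 ((isOpen_contractionBall c).mem_nhds hQ)] with t ht ht'
    exact aluthge_mul_binomialPow hc ht ht' lam
  have := (hA'.mul hF').unique ((hF'.mul hl).congr_of_eventuallyEq he)
  simp only [Function.comp_apply, hl0] at this
  exact this

/-- The coordinate of `Y` at `(i, j)` transversal to the unitary orbit of `diagonal d`. -/
noncomputable def transversalCoord (d : Fin r → ℂ) (Y : Mat r) (i j : Fin r) : ℂ :=
  Y i j / (d j - d i) + star (Y j i / (d i - d j))

theorem fderiv_aluthge_diagonal_sub {d : Fin r → ℂ} (hd : ∀ i, d i ≠ 0) (lam : ℝ) (Y : Mat r)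
    (i j : Fin r) :
    fderiv ℝ (aluthge lam) (Matrix.diagonal d) Y i j - Y i j =
      (d j - d i) * (aluthgeCoeff d lam i j * transversalCoord d Y i j) := by
  have hT := isUnit_diagonal hd
  obtain ⟨c, hc, hQ⟩ := exists_gram_mem_contractionBall hT
  have h1 := fderiv_aluthge_mul (lam := lam) hc hT hQ Y
  rw [gram_diagonal] at hQ h1
  have hb := (diagonal_mem_contractionBall_iff hc).1 hQ
  rw [binomialPow_diagonal _ (fun i => (hb i).1) fun i => (hb i).2, aluthge_diagonal hd] at h1
  have h2 := congrFun (congrFun h1 i) j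
  simp only [Matrix.add_apply, Matrix.mul_diagonal, Matrix.diagonal_mul] at h2
  have es : ∀ i, (‖d i‖ ^ 2) ^ (lam / 2) = ‖d i‖ ^ lam := fun i => by
    rw [← Real.rpow_natCast _ 2, ← Real.rpow_mul (norm_nonneg _)]
    congr 1
    push_cast
    ring
  have hpos : ∀ i, 0 < ‖d i‖ ^ lam := fun i => Real.rpow_pos_of_pos (norm_pos_iff.2 (hd i)) _
  have hne : ((‖d j‖ ^ lam : ℝ) : ℂ) ≠ 0 := Complex.ofReal_ne_zero.2 (hpos j).ne'
  rw [es, es] at h2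
  -- When `d_i = d_j`, the two terms containing the derivative of the power cancel, so its diagonal
  -- entries are never needed.
  by_cases hij : d i = d j
  · rw [hij] at h2 ⊢
    rw [sub_self, zero_mul, sub_eq_zero]
    refine mul_right_cancel₀ hne ?_
    linear_combination h2
  · have hij' : i ≠ j := fun e => hij (by rw [e])
    rw [fderiv_binomialPow_diagonal hc hb _ hij'] at h2
    simp only [Matrix.add_apply, Matrix.mul_diagonal, Matrix.diagonal_conjTranspose,
      Matrix.diagonal_mul, Matrix.conjTranspose_apply, Pi.star_apply] at h2
    -- The difference `|d_i|^λ - |d_j|^λ`, which multiplies `Y_ij`, is expressed by the same divided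
    -- difference as the remaining terms.
    have hk := rpowDiv_mul_sub (lam / 2) (‖d i‖ ^ 2) (‖d j‖ ^ 2)
    rw [es, es] at hk
    have hk' : ((rpowDiv (lam / 2) (‖d i‖ ^ 2) (‖d j‖ ^ 2) : ℝ) : ℂ) *
        (star (d i) * d i - star (d j) * d j) = ((‖d i‖ ^ lam : ℝ) : ℂ) - ((‖d j‖ ^ lam : ℝ) : ℂ) := by
      rw [← Complex.ofReal_sub, ← hk, RCLike.star_def, Complex.conj_mul',
        Complex.conj_mul']
      push_cast
      rfl
    have hn : ((‖d j‖ ^ 2 : ℝ) : ℂ) = star (d j) * d j := by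
      rw [RCLike.star_def, Complex.conj_mul']
      push_cast
      rfl
    have s1 : d j - d i ≠ 0 := sub_ne_zero.2 (Ne.symm hij)
    have s2 : star (d i) - star (d j) ≠ 0 := by
      rw [← star_sub]
      exact star_ne_zero.2 (sub_ne_zero.2 hij)
    rw [aluthgeCoeff, transversalCoord, hn, Real.rpow_neg (norm_nonneg _), Complex.ofReal_mul,
      Complex.ofReal_inv, star_div₀, star_sub]
    refine mul_right_cancel₀ hne ?_
    generalize ((rpowDiv (lam / 2) (‖d i‖ ^ 2) (‖d j‖ ^ 2) : ℝ) : ℂ) = k at *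
    generalize ((‖d i‖ ^ lam : ℝ) : ℂ) = p at *
    generalize ((‖d j‖ ^ lam : ℝ) : ℂ) = q at *
    generalize fderiv ℝ (aluthge lam) (Matrix.diagonal d) Y i j = A at *
    generalize Y i j = y at *
    generalize star (Y j i) = y' at *
    generalize star (d i) = a' at *
    generalize star (d j) = b' at *
    generalize d i = a at *
    generalize d j = b at *
    field_simp
    linear_combination (a' - b') * h2 - (a' - b') * y * hk'

end Derivative

/-! ### Tangent spaces of the two orbits at a diagonal matrix -/

section TangentSpaces

attribute [local instance] Matrix.frobeniusNormedRing Matrix.frobeniusNormedAlgebra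

variable {r : ℕ}

theorem tangentSpaceAt_mono {E : Type*} [NormedAddCommGroup E] [NormedSpace ℝ E] {S S' : Set E}
    (h : S ⊆ S') (x : E) : tangentSpaceAt S x ≤ tangentSpaceAt S' x := by
  refine Submodule.span_mono ?_
  rintro v ⟨γ, hγ⟩
  exact ⟨γ, hγ.smooth, hγ.mem.mono fun t ht => h ht, hγ.base, hγ.velocity⟩

theorem unitaryOrbit_subset_similarityOrbit (D : Mat r) : unitaryOrbit D ⊆ similarityOrbit D := by
  rintro N ⟨U, hU, rfl⟩
  have h : U * Uᴴ = 1 := Matrix.mem_unitaryGroup_iff.1 hU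
  exact ⟨U, ⟨⟨U, Uᴴ, h, Matrix.mem_unitaryGroup_iff'.1 hU⟩, rfl⟩,
    by rw [Matrix.inv_eq_right_inv h]⟩

theorem aeval_conj_eq {S : Mat r} (hS : IsUnit S) (X : Mat r) (p : Polynomial ℂ) :
    Polynomial.aeval (S * X * S⁻¹) p = S * Polynomial.aeval X p * S⁻¹ := by
  induction p using Polynomial.induction_on' with
  | add p q hp hq => rw [map_add, map_add, hp, hq, mul_add, add_mul]
  | monomial n a =>
    rw [Polynomial.aeval_monomial, Polynomial.aeval_monomial]
    rw [conj_pow_eq hS, ← mul_assoc, ← mul_assoc, Algebra.commutes, mul_assoc S _ (X ^ n), Algebra.commutes]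

theorem aeval_diagonal_eq (d : Fin r → ℂ) (p : Polynomial ℂ) :
    Polynomial.aeval (Matrix.diagonal d) p = Matrix.diagonal fun i => p.eval (d i) := by
  change Polynomial.aeval (Matrix.diagonalAlgHom ℂ d) p = _
  rw [Polynomial.aeval_algHom_apply]
  change Matrix.diagonal _ = _
  congr 1
  ext i
  change Pi.evalAlgHom ℂ (fun _ : Fin r => ℂ) i (Polynomial.aeval d p) = _
  rw [← Polynomial.aeval_algHom_apply]
  exact congrFun (Polynomial.coe_aeval_eq_eval (d i)) p

theorem differentiableAt_aeval {γ : ℝ → Mat r} {t : ℝ} (h : DifferentiableAt ℝ γ t)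
    (p : Polynomial ℂ) : DifferentiableAt ℝ (fun t => Polynomial.aeval (γ t) p) t := by
  simp_rw [Polynomial.aeval_eq_sum_range]
  exact DifferentiableAt.fun_sum fun n _ => (h.pow n).const_smul (p.coeff n)

/-- Let `q` be the product of `X - z` over the eigenvalues `z ≠ d_j`. Then `(X - d_j) q` annihilates
the whole orbit. In the derivative along `γ`, row `i` of `D - d_j` vanishes, and the `(i, j)` entry
leaves `v_ij q(d_j) = 0`. -/
theorem IsSmoothCurve.entry_eq_zero {d : Fin r → ℂ} {v : Mat r} {γ : ℝ → Mat r}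
    (h : IsSmoothCurve (similarityOrbit (Matrix.diagonal d)) (Matrix.diagonal d) v γ)
    {i j : Fin r} (hij : d i = d j) : v i j = 0 := by
  set q : Polynomial ℂ :=
    ∏ z ∈ (Finset.univ.image d).erase (d j), (Polynomial.X - Polynomial.C z)
  have hq : q.eval (d j) ≠ 0 := by
    rw [Polynomial.eval_prod, Finset.prod_ne_zero_iff]
    intro z hz
    simpa [sub_eq_zero] using (Finset.ne_of_mem_erase hz).symm
  have hq' : ∀ k, ((Polynomial.X - Polynomial.C (d j)) * q).eval (d k) = 0 := by
    intro k
    rw [Polynomial.eval_mul, Polynomial.eval_prod, mul_eq_zero, or_iff_not_imp_left]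
    intro hk
    refine Finset.prod_eq_zero (i := d k) ?_ (by simp)
    refine Finset.mem_erase.2 ⟨fun e => hk (by simp [e]), by simp⟩
  have hvan : (fun t => γ t - algebraMap ℂ (Mat r) (d j)) *
      (fun t => Polynomial.aeval (γ t) q) =ᶠ[𝓝 0] fun _ => 0 := by
    filter_upwards [h.mem] with t ht
    obtain ⟨S, hS, hγ⟩ := ht
    have : Polynomial.aeval (γ t) ((Polynomial.X - Polynomial.C (d j)) * q) = 0 := by
      rw [hγ, aeval_conj_eq hS, aeval_diagonal_eq]
      simp_rw [hq']
      simp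
    simpa using this
  have hd1 := h.velocity.sub_const (algebraMap ℂ (Mat r) (d j))
  have hd2 := (differentiableAt_aeval h.velocity.differentiableAt q).hasDerivAt
  have h0 := ((hd1.mul hd2).congr_of_eventuallyEq hvan.symm).unique (hasDerivAt_const (0 : ℝ) _)
  have h1 := congrFun (congrFun h0 i) j
  rw [h.base, aeval_diagonal_eq, Matrix.algebraMap_eq_diagonal, Matrix.diagonal_sub] at h1
  erw [Matrix.add_apply, Matrix.mul_diagonal, Matrix.diagonal_mul] at h1
  simp only [Pi.algebraMap_apply, Algebra.algebraMap_self, RingHom.id_apply, hij, sub_self,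
    zero_mul, add_zero, Matrix.zero_apply] at h1
  exact (mul_eq_zero.1 h1).resolve_right hq

theorem transversalCoord_add (d : Fin r → ℂ) (X Y : Mat r) (i j : Fin r) :
    transversalCoord d (X + Y) i j = transversalCoord d X i j + transversalCoord d Y i j := by
  simp only [transversalCoord, Matrix.add_apply, add_div, star_add]
  ring

theorem transversalCoord_smul (d : Fin r → ℂ) (t : ℝ) (Y : Mat r) (i j : Fin r) :
    transversalCoord d (t • Y) i j = t * transversalCoord d Y i j := by
  simp only [transversalCoord, Matrix.smul_apply, Complex.real_smul, mul_div_assoc, star_mul',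
    RCLike.star_def, Complex.conj_ofReal]
  ring

/-- The unitary orbit consists of normal matrices; differentiating `γγ* = γ*γ` gives an entrywise
relation that is the claim with denominators cleared. -/
theorem IsSmoothCurve.transversalCoord_eq_zero {d : Fin r → ℂ} {v : Mat r} {γ : ℝ → Mat r}
    (h : IsSmoothCurve (unitaryOrbit (Matrix.diagonal d)) (Matrix.diagonal d) v γ)
    (i j : Fin r) : transversalCoord d v i j = 0 := by
  have hs : HasDerivAt (fun t : ℝ => (γ t)ᴴ) vᴴ 0 :=
    (conjTransposeCLM r).hasFDerivAt.comp_hasDerivAt 0 h.velocity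
  have hnormal : γ * (fun t : ℝ => (γ t)ᴴ) =ᶠ[𝓝 0] (fun t : ℝ => (γ t)ᴴ) * γ := by
    filter_upwards [h.mem] with t ht
    obtain ⟨U, hU, hγ⟩ := ht
    have hUU : Uᴴ * U = 1 := Matrix.mem_unitaryGroup_iff'.1 hU
    change γ t * (γ t)ᴴ = (γ t)ᴴ * γ t
    rw [hγ, Matrix.conjTranspose_mul, Matrix.conjTranspose_mul, Matrix.conjTranspose_conjTranspose]
    have hD : Matrix.diagonal d * (Matrix.diagonal d)ᴴ =
        (Matrix.diagonal d)ᴴ * Matrix.diagonal d := by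
      rw [Matrix.diagonal_conjTranspose, Matrix.diagonal_mul_diagonal,
        Matrix.diagonal_mul_diagonal]
      simp_rw [mul_comm]
    calc _ = U * (Matrix.diagonal d * (Uᴴ * U) * (Matrix.diagonal d)ᴴ) * Uᴴ := by noncomm_ring
      _ = U * ((Matrix.diagonal d)ᴴ * (Uᴴ * U) * Matrix.diagonal d) * Uᴴ := by
        rw [hUU, mul_one, mul_one, hD]
      _ = _ := by noncomm_ring
  have h0 := ((hs.mul h.velocity).congr_of_eventuallyEq hnormal).unique (h.velocity.mul hs)
  have h1 := congrFun (congrFun h0 i) j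
  simp only [h.base, Matrix.diagonal_conjTranspose] at h1
  erw [Matrix.add_apply, Matrix.add_apply, Matrix.mul_diagonal, Matrix.mul_diagonal,
    Matrix.diagonal_mul, Matrix.diagonal_mul] at h1
  rw [Matrix.conjTranspose_apply, Pi.star_apply, Pi.star_apply] at h1
  by_cases hij : d i = d j
  · simp [transversalCoord, hij]
  have s1 : d j - d i ≠ 0 := sub_ne_zero.2 (Ne.symm hij)
  have s2 : star (d i) - star (d j) ≠ 0 := by
    rw [← star_sub]
    exact star_ne_zero.2 (sub_ne_zero.2 hij)
  rw [transversalCoord, star_div₀, star_sub]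
  generalize star (d i) = a' at *
  generalize star (d j) = b' at *
  generalize star (v j i) = y' at *
  field_simp
  linear_combination h1

theorem isSmoothCurve_exp_conj {S : Set (Mat r)} {D X : Mat r}
    (hS : ∀ t : ℝ, NormedSpace.exp (t • X) * D * NormedSpace.exp (t • (-X)) ∈ S) :
    IsSmoothCurve S D (X * D - D * X)
      fun t : ℝ => NormedSpace.exp (t • X) * D * NormedSpace.exp (t • (-X)) := by
  have hexp : ∀ X : Mat r, ContDiff ℝ ∞ fun t : ℝ => NormedSpace.exp (t • X) := fun X =>
    ContDiff.comp (g := NormedSpace.exp)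
      (contDiff_iff_contDiffAt.2 fun Z => (NormedSpace.exp_analytic (𝕂 := ℝ) Z).contDiffAt)
      (contDiff_id.smul contDiff_const)
  refine ⟨.of_forall fun t => (((hexp X).mul contDiff_const).mul (hexp (-X))).contDiffAt,
    .of_forall hS, by simp [NormedSpace.exp_zero], ?_⟩
  have h1 := hasDerivAt_exp_smul_const (𝕂 := ℝ) X 0
  have h2 := hasDerivAt_exp_smul_const (𝕂 := ℝ) (-X) 0
  have h3 := (h1.mul_const D).mul h2
  convert! h3 using 1
  simp only [zero_smul, NormedSpace.exp_zero]
  noncomm_ring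

theorem exp_mul_exp_neg (X : Mat r) (t : ℝ) :
    NormedSpace.exp (t • X) * NormedSpace.exp (t • (-X)) = 1 := by
  rw [smul_neg, Matrix.exp_neg]
  exact Matrix.mul_nonsing_inv _ ((Matrix.isUnit_iff_isUnit_det _).1 (Matrix.isUnit_exp _))

theorem commutator_mem_tangentSpaceAt_similarityOrbit (D X : Mat r) :
    X * D - D * X ∈ tangentSpaceAt (similarityOrbit D) D := by
  refine (isSmoothCurve_exp_conj fun t => ?_).mem_tangentSpaceAt
  exact ⟨_, Matrix.isUnit_exp (t • X), by rw [Matrix.inv_eq_right_inv (exp_mul_exp_neg X t)]⟩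

theorem commutator_mem_tangentSpaceAt_unitaryOrbit (D : Mat r) {X : Mat r} (hX : Xᴴ = -X) :
    X * D - D * X ∈ tangentSpaceAt (unitaryOrbit D) D := by
  refine (isSmoothCurve_exp_conj fun t => ?_).mem_tangentSpaceAt
  have he : (NormedSpace.exp (t • X))ᴴ = NormedSpace.exp (t • (-X)) := by
    rw [← Matrix.exp_conjTranspose, Matrix.conjTranspose_smul, hX, star_trivial]
  have hU : NormedSpace.exp (t • X) ∈ Matrix.unitaryGroup (Fin r) ℂ := by
    rw [Matrix.mem_unitaryGroup_iff, Matrix.star_eq_conjTranspose, he, exp_mul_exp_neg]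
  exact ⟨_, hU, by rw [he]⟩

/-- Where `d_i = d_j` the quotient is `0` by convention. The matrix `X` of quotients satisfies `X +
X* = w`, so it is skew-Hermitian exactly when all transversal coordinates vanish. -/
theorem eq_commutator {d : Fin r → ℂ} {Y : Mat r} (hY : ∀ i j, d i = d j → Y i j = 0) :
    Y = Matrix.of (fun i j => Y i j / (d j - d i)) * Matrix.diagonal d -
      Matrix.diagonal d * Matrix.of (fun i j => Y i j / (d j - d i)) := by
  ext i j
  rw [Matrix.sub_apply, Matrix.mul_diagonal, Matrix.diagonal_mul, Matrix.of_apply]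
  by_cases hij : d i = d j
  · simp [hY i j hij, hij]
  · have s1 : d j - d i ≠ 0 := sub_ne_zero.2 (Ne.symm hij)
    field_simp

theorem mem_tangentSpaceAt_similarityOrbit_iff {d : Fin r → ℂ} {Y : Mat r} :
    Y ∈ tangentSpaceAt (similarityOrbit (Matrix.diagonal d)) (Matrix.diagonal d) ↔
      ∀ i j, d i = d j → Y i j = 0 := by
  constructor
  · intro hY i j hij
    induction hY using Submodule.span_induction with
    | mem v hv => exact hv.elim fun γ hγ => hγ.entry_eq_zero hij
    | zero => rfl
    | add X Z _ _ hX hZ => rw [Matrix.add_apply, hX, hZ, add_zero]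
    | smul t X _ hX => rw [Matrix.smul_apply, hX, smul_zero]
  · intro hY
    rw [eq_commutator hY]
    exact commutator_mem_tangentSpaceAt_similarityOrbit _ _

theorem mem_tangentSpaceAt_unitaryOrbit_iff {d : Fin r → ℂ} {Y : Mat r} :
    Y ∈ tangentSpaceAt (unitaryOrbit (Matrix.diagonal d)) (Matrix.diagonal d) ↔
      (∀ i j, d i = d j → Y i j = 0) ∧ ∀ i j, transversalCoord d Y i j = 0 := by
  constructor
  · intro hY
    refine ⟨mem_tangentSpaceAt_similarityOrbit_iff.1
      (tangentSpaceAt_mono (unitaryOrbit_subset_similarityOrbit _) _ hY), fun i j => ?_⟩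
    induction hY using Submodule.span_induction with
    | mem v hv => exact hv.elim fun γ hγ => hγ.transversalCoord_eq_zero i j
    | zero => simp [transversalCoord]
    | add X Z _ _ hX hZ => rw [transversalCoord_add, hX, hZ, add_zero]
    | smul t X _ hX => rw [transversalCoord_smul, hX, mul_zero]
  · rintro ⟨hY, hw⟩
    rw [eq_commutator hY]
    refine commutator_mem_tangentSpaceAt_unitaryOrbit _ ?_
    ext i j
    rw [Matrix.conjTranspose_apply, Matrix.neg_apply, Matrix.of_apply, Matrix.of_apply]
    exact eq_neg_of_add_eq_zero_right (hw i j)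

end TangentSpaces

/-! ### The operator `B`: kernel, range and contraction -/

section DerivativeSub

variable {r : ℕ}

/-- The derivative of the Aluthge transform at `N`, minus the identity. -/
noncomputable def derivSub (lam : ℝ) (N : Mat r) : BoundedOperator (Mat r) :=
  fderiv ℝ (aluthge lam) N - ContinuousLinearMap.id ℝ (Mat r)

theorem derivSub_apply (lam : ℝ) (N X : Mat r) :
    derivSub lam N X = fderiv ℝ (aluthge lam) N X - X := rfl

theorem fderiv_aluthge_apply (lam : ℝ) (N X : Mat r) :
    fderiv ℝ (aluthge lam) N X = X + derivSub lam N X := by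
  rw [derivSub_apply, add_sub_cancel]

theorem derivSub_diagonal_apply {d : Fin r → ℂ} (hd : ∀ i, d i ≠ 0) (lam : ℝ) (Y : Mat r)
    (i j : Fin r) :
    derivSub lam (Matrix.diagonal d) Y i j =
      (d j - d i) * (aluthgeCoeff d lam i j * transversalCoord d Y i j) :=
  fderiv_aluthge_diagonal_sub hd lam Y i j

theorem star_transversalCoord (d : Fin r → ℂ) (Y : Mat r) (i j : Fin r) :
    star (transversalCoord d Y i j) = transversalCoord d Y j i := by
  rw [transversalCoord, transversalCoord, star_add, star_star, add_comm]

theorem transversalCoord_of_eq {d : Fin r → ℂ} (Y : Mat r) {i j : Fin r} (h : d i = d j) :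
    transversalCoord d Y i j = 0 := by
  simp [transversalCoord, h]

/-- Dividing `(BY)_ij` by `d_j - d_i` leaves `c_ij w_ij`. As `w` is Hermitian, adding the conjugate
of the `(j, i)` quotient yields `(c_ij + conj c_ji) w_ij`. -/
theorem transversalCoord_derivSub {d : Fin r → ℂ} (hd : ∀ i, d i ≠ 0) (lam : ℝ) (Y : Mat r)
    (i j : Fin r) :
    transversalCoord d (derivSub lam (Matrix.diagonal d) Y) i j =
      aluthgeEig d lam i j * transversalCoord d Y i j := by
  by_cases hij : d i = d j
  · rw [transversalCoord_of_eq _ hij, transversalCoord_of_eq _ hij, mul_zero]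
  · rw [transversalCoord, derivSub_diagonal_apply hd, derivSub_diagonal_apply hd,
      mul_div_cancel_left₀ _ (sub_ne_zero.2 (Ne.symm hij)),
      mul_div_cancel_left₀ _ (sub_ne_zero.2 hij), star_mul', star_transversalCoord, aluthgeEig]
    ring

theorem derivSub_derivSub {d : Fin r → ℂ} (hd : ∀ i, d i ≠ 0) (lam : ℝ) (Y : Mat r)
    (i j : Fin r) :
    derivSub lam (Matrix.diagonal d) (derivSub lam (Matrix.diagonal d) Y) i j =
      aluthgeEig d lam i j * derivSub lam (Matrix.diagonal d) Y i j := by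
  rw [derivSub_diagonal_apply hd, transversalCoord_derivSub hd, derivSub_diagonal_apply hd]
  ring

theorem derivSub_eq_zero_of_derivSub_derivSub {d : Fin r → ℂ} (hd : ∀ i, d i ≠ 0) {lam : ℝ}
    (h0 : 0 < lam) (h1 : lam < 1) {Y : Mat r}
    (h : derivSub lam (Matrix.diagonal d) (derivSub lam (Matrix.diagonal d) Y) = 0) :
    derivSub lam (Matrix.diagonal d) Y = 0 := by
  ext i j
  by_cases hij : d i = d j
  · rw [derivSub_diagonal_apply hd, hij, sub_self, zero_mul, Matrix.zero_apply]
  · have := congrFun (congrFun h i) j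
    rw [derivSub_derivSub hd] at this
    exact (mul_eq_zero.1 this).resolve_left (aluthgeEig_ne_zero hd h0 h1 hij)

theorem derivSub_eq_zero_of_transversalCoord {d : Fin r → ℂ} (hd : ∀ i, d i ≠ 0) (lam : ℝ)
    {Y : Mat r} (h : ∀ i j, transversalCoord d Y i j = 0) :
    derivSub lam (Matrix.diagonal d) Y = 0 := by
  ext i j
  rw [derivSub_diagonal_apply hd, h, mul_zero, mul_zero, Matrix.zero_apply]

theorem derivSub_mem_tangentSpaceAt {d : Fin r → ℂ} (hd : ∀ i, d i ≠ 0) (lam : ℝ) (Y : Mat r) :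
    derivSub lam (Matrix.diagonal d) Y ∈
      tangentSpaceAt (similarityOrbit (Matrix.diagonal d)) (Matrix.diagonal d) := by
  refine mem_tangentSpaceAt_similarityOrbit_iff.2 fun i j hij => ?_
  rw [derivSub_diagonal_apply hd, hij, sub_self, zero_mul]

/-- Since `μ_ji = conj μ_ij`, dividing `Y` entrywise by `μ` divides its transversal coordinates by
`μ`, and `B` multiplies them back. Hence `Y - BZ` has no transversal part. -/
theorem exists_derivSub_add {d : Fin r → ℂ} (hd : ∀ i, d i ≠ 0) {lam : ℝ}
    (h0 : 0 < lam) (h1 : lam < 1) {Y : Mat r}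
    (hY : Y ∈ tangentSpaceAt (similarityOrbit (Matrix.diagonal d)) (Matrix.diagonal d)) :
    ∃ Z, Y - derivSub lam (Matrix.diagonal d) Z ∈
      tangentSpaceAt (unitaryOrbit (Matrix.diagonal d)) (Matrix.diagonal d) := by
  let Z : Mat r := Matrix.of fun i j => (aluthgeEig d lam i j)⁻¹ * Y i j
  have hZ : ∀ i j, transversalCoord d Z i j =
      (aluthgeEig d lam i j)⁻¹ * transversalCoord d Y i j := fun i j => by
    rw [transversalCoord, transversalCoord, ← star_aluthgeEig]
    simp only [Z, Matrix.of_apply, star_div₀, star_mul', star_inv₀]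
    rw [← star_aluthgeEig d lam i j, star_star]
    ring
  refine ⟨Z, mem_tangentSpaceAt_unitaryOrbit_iff.2 ⟨fun i j hij => ?_, fun i j => ?_⟩⟩
  · rw [Matrix.sub_apply, mem_tangentSpaceAt_similarityOrbit_iff.1 hY i j hij,
      derivSub_diagonal_apply hd, hij, sub_self, zero_mul, sub_zero]
  · by_cases hij : d i = d j
    · exact transversalCoord_of_eq _ hij
    · rw [sub_eq_add_neg, ← neg_one_smul ℝ, transversalCoord_add, transversalCoord_smul,
        transversalCoord_derivSub hd, hZ, mul_inv_cancel_left₀ (aluthgeEig_ne_zero hd h0 h1 hij)]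
      simp

theorem frobenius_norm_sq (X : Mat r) : ‖X‖ ^ 2 = ∑ i, ∑ j, ‖X i j‖ ^ 2 := by
  rw [Matrix.frobenius_norm_def, ← Real.sqrt_eq_rpow, Real.sq_sqrt (by positivity)]
  simp

theorem trace_conjTranspose_mul_self_re (X : Mat r) : (Matrix.trace (Xᴴ * X)).re = ‖X‖ ^ 2 := by
  rw [frobenius_norm_sq, Finset.sum_comm, Matrix.trace, Complex.re_sum]
  refine Finset.sum_congr rfl fun j _ => ?_
  rw [Matrix.diag_apply, Matrix.mul_apply, Complex.re_sum]
  refine Finset.sum_congr rfl fun i _ => ?_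
  rw [Matrix.conjTranspose_apply, RCLike.star_def, Complex.conj_mul']
  norm_cast

/-- The squared Frobenius norm is a sum over entries, and `1 + B` multiplies each entry of a matrix
in the range of `B` by `1 + μ_ij`. -/
theorem norm_fderiv_derivSub_le {d : Fin r → ℂ} (hd : ∀ i, d i ≠ 0) {lam : ℝ}
    (h0 : 0 < lam) (h1 : lam < 1) (Y : Mat r) :
    ‖derivSub lam (Matrix.diagonal d) Y +
        derivSub lam (Matrix.diagonal d) (derivSub lam (Matrix.diagonal d) Y)‖ ≤
      contractionConst d lam * ‖derivSub lam (Matrix.diagonal d) Y‖ := by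
  have hk : 0 ≤ contractionConst d lam :=
    le_max_of_le_left (Real.iSup_nonneg fun p => by positivity)
  refine (sq_le_sq₀ (norm_nonneg _) (mul_nonneg hk (norm_nonneg _))).1 ?_
  rw [mul_pow, frobenius_norm_sq, frobenius_norm_sq, Finset.mul_sum]
  refine Finset.sum_le_sum fun i _ => ?_
  rw [Finset.mul_sum]
  refine Finset.sum_le_sum fun j _ => ?_
  rw [← mul_pow]
  refine pow_le_pow_left₀ (norm_nonneg _) ?_ 2
  by_cases hij : d i = d j
  · simp [derivSub_diagonal_apply hd, hij]
  · rw [Matrix.add_apply, derivSub_derivSub hd, ← one_add_mul, norm_mul]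
    exact mul_le_mul_of_nonneg_right (norm_one_add_aluthgeEig_le hd h0 h1 hij) (norm_nonneg _)

/-- Such an `X` is supported on the entries with `d_i = d_j`, which `B` ignores. A projection that
kills the kernel of `B` thus vanishes on the orthogonal complement too. -/
theorem derivSub_eq_zero_of_orthogonal {d : Fin r → ℂ} (hd : ∀ i, d i ≠ 0) (lam : ℝ) {X : Mat r}
    (hX : ∀ Y ∈ tangentSpaceAt (similarityOrbit (Matrix.diagonal d)) (Matrix.diagonal d),
      (Matrix.trace (Yᴴ * X)).re = 0) :
    derivSub lam (Matrix.diagonal d) X = 0 := by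
  have hz : ∀ i j, d i ≠ d j → X i j = 0 := fun i j hij => by
    -- This test matrix makes the trace equal to `|X_ij|²`.
    have h := hX (Matrix.single i j (X i j)) (mem_tangentSpaceAt_similarityOrbit_iff.2 ?_)
    · rw [Matrix.conjTranspose_single, Matrix.trace_single_mul, RCLike.star_def, smul_eq_mul,
        Complex.conj_mul'] at h
      norm_cast at h
      simpa using h
    · intro k l hkl
      refine Matrix.single_apply_of_ne _ _ _ _ _ ?_
      rintro ⟨rfl, rfl⟩
      exact hij hkl
  refine derivSub_eq_zero_of_transversalCoord hd lam fun i j => ?_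
  by_cases hij : d i = d j
  · exact transversalCoord_of_eq _ hij
  · simp [transversalCoord, hz i j hij, hz j i (Ne.symm hij)]

end DerivativeSub

/-! ### Transport along unitary conjugation -/

section UnitaryConjugation

variable {r : ℕ}

theorem conj_conj_of_mul_eq_one {U V : Mat r} (h : V * U = 1) (h' : Uᴴ * Vᴴ = 1) (X : Mat r) :
    V * (U * X * Uᴴ) * Vᴴ = X := by
  calc _ = (V * U) * X * (Uᴴ * Vᴴ) := by noncomm_ring
    _ = X := by rw [h, h', one_mul, mul_one]

/-- Conjugation by a unitary matrix, as a real continuous linear equivalence. -/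
noncomputable def unitaryConj (U : Matrix.unitaryGroup (Fin r) ℂ) : Mat r ≃L[ℝ] Mat r :=
  LinearEquiv.toContinuousLinearEquiv
    { toFun := fun X => U * X * (U : Mat r)ᴴ
      invFun := fun X => (U : Mat r)ᴴ * X * U
      map_add' := fun X Y => by rw [mul_add, add_mul]
      map_smul' := fun t X => by rw [mul_smul_comm, smul_mul_assoc, RingHom.id_apply]
      left_inv := fun X => by
        have h : (U : Mat r)ᴴ * U = 1 := Matrix.mem_unitaryGroup_iff'.1 U.2
        simpa using conj_conj_of_mul_eq_one (U := (U : Mat r)) (V := (U : Mat r)ᴴ) h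
          (by simpa using h) X
      right_inv := fun X => by
        have h : (U : Mat r) * (U : Mat r)ᴴ = 1 := Matrix.mem_unitaryGroup_iff.1 U.2
        simpa using conj_conj_of_mul_eq_one (U := (U : Mat r)ᴴ) (V := (U : Mat r)) h
          (by simpa using h) X }

theorem unitaryConj_apply (U : Matrix.unitaryGroup (Fin r) ℂ) (X : Mat r) :
    unitaryConj U X = U * X * (U : Mat r)ᴴ := rfl

theorem unitaryConj_symm (U : Matrix.unitaryGroup (Fin r) ℂ) (X : Mat r) :
    (unitaryConj U).symm X = unitaryConj U⁻¹ X := by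
  change (U : Mat r)ᴴ * X * U = (U : Mat r)ᴴ * X * ((U : Mat r)ᴴ)ᴴ
  rw [Matrix.conjTranspose_conjTranspose]

theorem trace_unitaryConj (U : Matrix.unitaryGroup (Fin r) ℂ) (X Y : Mat r) :
    Matrix.trace ((unitaryConj U X)ᴴ * unitaryConj U Y) = Matrix.trace (Xᴴ * Y) := by
  have h : (U : Mat r)ᴴ * (U : Mat r) = 1 := Matrix.mem_unitaryGroup_iff'.1 U.2
  rw [unitaryConj_apply, unitaryConj_apply, Matrix.conjTranspose_mul, Matrix.conjTranspose_mul,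
    Matrix.conjTranspose_conjTranspose]
  calc _ = Matrix.trace ((U : Mat r) * (Xᴴ * ((U : Mat r)ᴴ * (U : Mat r)) * Y * (U : Mat r)ᴴ)) := by
        congr 1; noncomm_ring
    _ = Matrix.trace (Xᴴ * Y) := by
        rw [Matrix.trace_mul_comm, h, mul_one, mul_assoc, h, mul_one]

theorem norm_unitaryConj (U : Matrix.unitaryGroup (Fin r) ℂ) (X : Mat r) :
    ‖unitaryConj U X‖ = ‖X‖ := by
  have h := congrArg Complex.re (trace_unitaryConj U X X)
  rw [trace_conjTranspose_mul_self_re, trace_conjTranspose_mul_self_re] at h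
  exact (sq_eq_sq₀ (norm_nonneg _) (norm_nonneg _)).1 h

/-- Differentiate the equivariance of the transform, valid on a neighbourhood of `D` because
invertibility is an open condition. -/
theorem derivSub_unitaryConj (U : Matrix.unitaryGroup (Fin r) ℂ) {D : Mat r} (hD : IsUnit D)
    (lam : ℝ) (Y : Mat r) :
    derivSub lam (unitaryConj U D) (unitaryConj U Y) = unitaryConj U (derivSub lam D Y) := by
  have hu : IsUnit (U : Mat r) := Unitary.isUnit_coe
  have hN : IsUnit (unitaryConj U D) := (hu.mul hD).mul hu.star
  have h1 := ((contDiffAt_aluthge hN lam).differentiableAt (by simp)).hasFDerivAt.comp D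
    (unitaryConj U).hasFDerivAt
  have h2 := (unitaryConj U).hasFDerivAt.comp D
    ((contDiffAt_aluthge hD lam).differentiableAt (by simp)).hasFDerivAt
  have he : aluthge lam ∘ unitaryConj U =ᶠ[𝓝 D] unitaryConj U ∘ aluthge lam := by
    filter_upwards [eventually_isUnit hD] with X hX
    exact aluthge_unitary_conj U.2 hX lam
  have h3 := congrArg (fun A : Mat r →L[ℝ] Mat r => A Y) (h1.unique (h2.congr_of_eventuallyEq he))
  rw [derivSub_apply, derivSub_apply, map_sub]
  exact congrArg (· - unitaryConj U Y) h3

theorem map_mem_tangentSpaceAt {E : Type*} [NormedAddCommGroup E] [NormedSpace ℝ E] {S : Set E}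
    (C : E →L[ℝ] E) (hC : Set.MapsTo C S S) {x v : E} (hv : v ∈ tangentSpaceAt S x) :
    C v ∈ tangentSpaceAt S (C x) := by
  suffices tangentSpaceAt S x ≤ (tangentSpaceAt S (C x)).comap (C : E →ₗ[ℝ] E) from this hv
  refine Submodule.span_le.2 ?_
  rintro v ⟨γ, hγ⟩
  have : IsSmoothCurve S (C x) (C v) (C ∘ γ) :=
    ⟨hγ.smooth.mono fun t ht => C.contDiff.contDiffAt.comp t ht, hγ.mem.mono fun t ht => hC ht,
      congrArg C hγ.base, C.hasFDerivAt.comp_hasDerivAt 0 hγ.velocity⟩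
  exact this.mem_tangentSpaceAt

theorem mapsTo_unitaryConj_similarityOrbit (U : Matrix.unitaryGroup (Fin r) ℂ) (D : Mat r) :
    Set.MapsTo (unitaryConj U) (similarityOrbit D) (similarityOrbit D) := by
  rintro _ ⟨S, hS, rfl⟩
  have h : (U : Mat r) * (U : Mat r)ᴴ = 1 := Matrix.mem_unitaryGroup_iff.1 U.2
  refine ⟨U * S, Unitary.isUnit_coe.mul hS, ?_⟩
  rw [unitaryConj_apply, Matrix.mul_inv_rev, Matrix.inv_eq_right_inv h]
  noncomm_ring

theorem mapsTo_unitaryConj_unitaryOrbit (U : Matrix.unitaryGroup (Fin r) ℂ) (D : Mat r) :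
    Set.MapsTo (unitaryConj U) (unitaryOrbit D) (unitaryOrbit D) := by
  rintro _ ⟨V, hV, rfl⟩
  refine ⟨U * V, mul_mem U.2 hV, ?_⟩
  rw [unitaryConj_apply, Matrix.conjTranspose_mul]
  noncomm_ring

theorem unitaryConj_mem_tangentSpaceAt {S : Set (Mat r)} {U : Matrix.unitaryGroup (Fin r) ℂ}
    (hS : Set.MapsTo (unitaryConj U) S S) {D Y : Mat r} (hY : Y ∈ tangentSpaceAt S D) :
    unitaryConj U Y ∈ tangentSpaceAt S (unitaryConj U D) :=
  map_mem_tangentSpaceAt (unitaryConj U : Mat r →L[ℝ] Mat r) hS hY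

theorem unitaryConj_mem_tangentSpaceAt_iff {S : Set (Mat r)}
    (hS : ∀ U : Matrix.unitaryGroup (Fin r) ℂ, Set.MapsTo (unitaryConj U) S S)
    (U : Matrix.unitaryGroup (Fin r) ℂ) {D Y : Mat r} :
    unitaryConj U Y ∈ tangentSpaceAt S (unitaryConj U D) ↔ Y ∈ tangentSpaceAt S D := by
  have e : ∀ X, unitaryConj U⁻¹ (unitaryConj U X) = X := fun X => by
    rw [← unitaryConj_symm, ContinuousLinearEquiv.symm_apply_apply]
  refine ⟨fun h => ?_, fun h => unitaryConj_mem_tangentSpaceAt (hS U) h⟩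
  have := unitaryConj_mem_tangentSpaceAt (hS U⁻¹) h
  rwa [e, e] at this

end UnitaryConjugation

/-! ### Projection onto the range as a polynomial in the operator -/

section SpectralProjection

variable {E : Type*} [NormedAddCommGroup E] [NormedSpace ℝ E]

theorem aeval_apply_of_apply_eq_zero {f : E →L[ℝ] E} {x : E} (h : f x = 0) (m : Polynomial ℝ) :
    Polynomial.aeval f m x = m.eval 0 • x := by
  induction m using Polynomial.induction_on' with
  | add p q hp hq => simp [hp, hq, add_smul]
  | monomial n a =>
    cases n with
    | zero => simp [Algebra.algebraMap_eq_smul_one]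
    | succ n =>
      simp [Polynomial.aeval_monomial, Algebra.algebraMap_eq_smul_one, pow_succ, h]

theorem aeval_apply_of_semiconj {f g : E →L[ℝ] E} {C : E → E} (hadd : ∀ x y, C (x + y) = C x + C y)
    (hsmul : ∀ (t : ℝ) x, C (t • x) = t • C x) (h : ∀ x, g (C x) = C (f x)) (m : Polynomial ℝ)
    (x : E) : Polynomial.aeval g m (C x) = C (Polynomial.aeval f m x) := by
  induction m using Polynomial.induction_on' with
  | add p q hp hq => simp [hp, hq, hadd]
  | monomial n a =>
    have hn : ∀ (n : ℕ) x, (g ^ n) (C x) = C ((f ^ n) x) := fun n => by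
      induction n with
      | zero => simp
      | succ n ih => intro x; rw [pow_succ, pow_succ]; simp [h, ih]
    simp [Polynomial.aeval_monomial, Algebra.algebraMap_eq_smul_one, hn, hsmul]

/-- Factor the minimal polynomial as `X^n m` with `m(0) ≠ 0`. By hypothesis the kernel of `f^n` lies
in that of `f`, so `f^n m(f) = 0` improves to `f m(f) = 0`. -/
theorem exists_aeval_apply_apply_eq_zero [FiniteDimensional ℝ E] {f : E →L[ℝ] E}
    (hf : ∀ x, f (f x) = 0 → f x = 0) :
    ∃ m : Polynomial ℝ, m.eval 0 ≠ 0 ∧ ∀ x, Polynomial.aeval f m (f x) = 0 := by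
  have hint : IsIntegral ℝ f := Algebra.IsIntegral.isIntegral f
  obtain ⟨m, hm, hdvd⟩ := Polynomial.exists_eq_pow_rootMultiplicity_mul_and_not_dvd
    (minpoly ℝ f) (minpoly.ne_zero hint) 0
  refine ⟨m, fun h => hdvd (Polynomial.dvd_iff_isRoot.2 h), fun x => ?_⟩
  have hker : ∀ (n : ℕ) y, (f ^ n) y = 0 → f y = 0 := by
    intro n
    induction n with
    | zero => intro y hy; have : y = 0 := by simpa using hy
              rw [this, map_zero]
    | succ n ih => intro y hy; exact hf y (ih (f y) (by simpa [pow_succ] using hy))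
  have h0 := minpoly.aeval ℝ f
  rw [hm, map_mul, map_pow, Polynomial.C_0, sub_zero, Polynomial.aeval_X] at h0
  have h1 : f (Polynomial.aeval f m x) = 0 :=
    hker _ _ (congrArg (fun A : E →L[ℝ] E => A x) h0)
  have hc : Commute (Polynomial.aeval f m) f := by
    have := Polynomial.aeval_X (R := ℝ) f ▸ (Commute.all m Polynomial.X).map (Polynomial.aeval f)
    exact this
  exact (congrArg (fun A : E →L[ℝ] E => A x) hc.eq).trans h1

theorem contDiff_aeval (m : Polynomial ℝ) :
    ContDiff ℝ ∞ fun f : E →L[ℝ] E => Polynomial.aeval f m := by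
  simp_rw [Polynomial.aeval_eq_sum_range]
  exact ContDiff.sum fun n _ => (contDiff_id.pow n).const_smul (m.coeff n)

end SpectralProjection

/-! ### The stable spaces along the unitary orbit -/

section StableSpace

variable {r : ℕ}

/-- The stable subspace at `N`: the range of the derivative of the Aluthge transform minus the
identity. -/
noncomputable def stableSpace (lam : ℝ) (N : Mat r) : Submodule ℝ (Mat r) :=
  LinearMap.range (derivSub lam N : Mat r →ₗ[ℝ] Mat r)

theorem mem_stableSpace {lam : ℝ} {N X : Mat r} :
    X ∈ stableSpace lam N ↔ ∃ Z, derivSub lam N Z = X := Iff.rfl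

theorem mem_unitaryOrbit_iff {D N : Mat r} :
    N ∈ unitaryOrbit D ↔ ∃ U : Matrix.unitaryGroup (Fin r) ℂ, N = unitaryConj U D :=
  ⟨fun ⟨U, hU, h⟩ => ⟨⟨U, hU⟩, h⟩, fun ⟨U, h⟩ => ⟨U, U.2, h⟩⟩

theorem exists_unitaryConj_eq (U : Matrix.unitaryGroup (Fin r) ℂ) (X : Mat r) :
    ∃ Y, unitaryConj U Y = X := (unitaryConj U).surjective X

theorem unitaryConj_mem_stableSpace {D : Mat r} (hD : IsUnit D) (lam : ℝ)
    (U : Matrix.unitaryGroup (Fin r) ℂ) {Y : Mat r} :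
    unitaryConj U Y ∈ stableSpace lam (unitaryConj U D) ↔ Y ∈ stableSpace lam D := by
  rw [mem_stableSpace, mem_stableSpace]
  constructor
  · rintro ⟨Z, hZ⟩
    obtain ⟨W, rfl⟩ := exists_unitaryConj_eq U Z
    rw [derivSub_unitaryConj U hD] at hZ
    exact ⟨W, (unitaryConj U).injective hZ⟩
  · rintro ⟨Z, rfl⟩
    exact ⟨unitaryConj U Z, derivSub_unitaryConj U hD lam Z⟩

theorem isUnit_of_mem_unitaryOrbit {d : Fin r → ℂ} (hd : ∀ i, d i ≠ 0) {N : Mat r}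
    (hN : N ∈ unitaryOrbit (Matrix.diagonal d)) : IsUnit N :=
  isUnit_of_mem_similarityOrbit (isUnit_diagonal hd) (unitaryOrbit_subset_similarityOrbit _ hN)

theorem aluthge_eq_self {d : Fin r → ℂ} (hd : ∀ i, d i ≠ 0) (lam : ℝ) {N : Mat r}
    (hN : N ∈ unitaryOrbit (Matrix.diagonal d)) : aluthge lam N = N := by
  obtain ⟨U, hU, rfl⟩ := hN
  rw [aluthge_unitary_conj hU (isUnit_diagonal hd), aluthge_diagonal hd]

theorem stableSpace_le_tangentSpaceAt {d : Fin r → ℂ} (hd : ∀ i, d i ≠ 0) (lam : ℝ) {N : Mat r}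
    (hN : N ∈ unitaryOrbit (Matrix.diagonal d)) :
    stableSpace lam N ≤ tangentSpaceAt (similarityOrbit (Matrix.diagonal d)) N := by
  obtain ⟨U, rfl⟩ := mem_unitaryOrbit_iff.1 hN
  intro X hX
  obtain ⟨Y, rfl⟩ := exists_unitaryConj_eq U X
  obtain ⟨Z, rfl⟩ := (unitaryConj_mem_stableSpace (isUnit_diagonal hd) lam U).1 hX
  exact unitaryConj_mem_tangentSpaceAt (mapsTo_unitaryConj_similarityOrbit U _)
    (derivSub_mem_tangentSpaceAt hd lam Z)

theorem derivSub_eq_zero_of_mem_tangentSpaceAt {d : Fin r → ℂ} (hd : ∀ i, d i ≠ 0) (lam : ℝ)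
    {N : Mat r} (hN : N ∈ unitaryOrbit (Matrix.diagonal d)) {X : Mat r}
    (hX : X ∈ tangentSpaceAt (unitaryOrbit (Matrix.diagonal d)) N) : derivSub lam N X = 0 := by
  obtain ⟨U, rfl⟩ := mem_unitaryOrbit_iff.1 hN
  obtain ⟨Y, rfl⟩ := exists_unitaryConj_eq U X
  rw [unitaryConj_mem_tangentSpaceAt_iff fun V => mapsTo_unitaryConj_unitaryOrbit V _] at hX
  rw [derivSub_unitaryConj U (isUnit_diagonal hd), derivSub_eq_zero_of_transversalCoord hd lam
    (mem_tangentSpaceAt_unitaryOrbit_iff.1 hX).2, map_zero]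

theorem derivSub_eq_zero_of_forall_trace {d : Fin r → ℂ} (hd : ∀ i, d i ≠ 0) (lam : ℝ)
    {N : Mat r} (hN : N ∈ unitaryOrbit (Matrix.diagonal d)) {X : Mat r}
    (hX : ∀ Y ∈ tangentSpaceAt (similarityOrbit (Matrix.diagonal d)) N,
      (Matrix.trace (Yᴴ * X)).re = 0) : derivSub lam N X = 0 := by
  obtain ⟨U, rfl⟩ := mem_unitaryOrbit_iff.1 hN
  obtain ⟨Z, rfl⟩ := exists_unitaryConj_eq U X
  rw [derivSub_unitaryConj U (isUnit_diagonal hd),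
    derivSub_eq_zero_of_orthogonal hd lam fun Y hY => ?_, map_zero]
  rw [← trace_unitaryConj U]
  exact hX _ (unitaryConj_mem_tangentSpaceAt (mapsTo_unitaryConj_similarityOrbit U _) hY)

theorem stableSpace_sup_tangentSpaceAt {d : Fin r → ℂ} (hd : ∀ i, d i ≠ 0) {lam : ℝ}
    (h0 : 0 < lam) (h1 : lam < 1) {N : Mat r} (hN : N ∈ unitaryOrbit (Matrix.diagonal d)) :
    stableSpace lam N ⊔ tangentSpaceAt (unitaryOrbit (Matrix.diagonal d)) N =
      tangentSpaceAt (similarityOrbit (Matrix.diagonal d)) N := by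
  refine le_antisymm (sup_le (stableSpace_le_tangentSpaceAt hd lam hN)
    (tangentSpaceAt_mono (unitaryOrbit_subset_similarityOrbit _) _)) fun X hX => ?_
  obtain ⟨U, rfl⟩ := mem_unitaryOrbit_iff.1 hN
  obtain ⟨Y, rfl⟩ := exists_unitaryConj_eq U X
  rw [unitaryConj_mem_tangentSpaceAt_iff fun V => mapsTo_unitaryConj_similarityOrbit V _] at hX
  obtain ⟨Z, hZ⟩ := exists_derivSub_add hd h0 h1 hX
  refine Submodule.mem_sup.2 ⟨_, (unitaryConj_mem_stableSpace (isUnit_diagonal hd) lam U).2 ⟨Z, rfl⟩,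
    _, unitaryConj_mem_tangentSpaceAt (mapsTo_unitaryConj_unitaryOrbit U _) hZ, ?_⟩
  rw [← map_add]
  exact congrArg _ (add_sub_cancel _ _)

theorem derivSub_eq_zero_of_derivSub_derivSub_eq_zero {d : Fin r → ℂ} (hd : ∀ i, d i ≠ 0) {lam : ℝ}
    (h0 : 0 < lam) (h1 : lam < 1) {N : Mat r} (hN : N ∈ unitaryOrbit (Matrix.diagonal d))
    {X : Mat r} (hX : derivSub lam N (derivSub lam N X) = 0) : derivSub lam N X = 0 := by
  obtain ⟨U, rfl⟩ := mem_unitaryOrbit_iff.1 hN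
  obtain ⟨Y, rfl⟩ := exists_unitaryConj_eq U X
  have hD := isUnit_diagonal hd
  rw [derivSub_unitaryConj U hD, derivSub_unitaryConj U hD] at hX
  have hX' := (unitaryConj U).injective (hX.trans (map_zero (unitaryConj U)).symm)
  rw [derivSub_unitaryConj U hD, derivSub_eq_zero_of_derivSub_derivSub hd h0 h1 hX', map_zero]

theorem stableSpace_inf_tangentSpaceAt {d : Fin r → ℂ} (hd : ∀ i, d i ≠ 0) {lam : ℝ}
    (h0 : 0 < lam) (h1 : lam < 1) {N : Mat r} (hN : N ∈ unitaryOrbit (Matrix.diagonal d)) :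
    stableSpace lam N ⊓ tangentSpaceAt (unitaryOrbit (Matrix.diagonal d)) N = ⊥ := by
  refine (Submodule.eq_bot_iff _).2 fun X hX => ?_
  obtain ⟨⟨Z, rfl⟩, hX'⟩ := hX
  exact derivSub_eq_zero_of_derivSub_derivSub_eq_zero hd h0 h1 hN
    (derivSub_eq_zero_of_mem_tangentSpaceAt hd lam hN hX')

theorem norm_fderiv_le_of_mem_stableSpace {d : Fin r → ℂ} (hd : ∀ i, d i ≠ 0) {lam : ℝ}
    (h0 : 0 < lam) (h1 : lam < 1) {N : Mat r} (hN : N ∈ unitaryOrbit (Matrix.diagonal d))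
    {X : Mat r} (hX : X ∈ stableSpace lam N) :
    ‖fderiv ℝ (aluthge lam) N X‖ ≤ contractionConst d lam * ‖X‖ := by
  obtain ⟨U, rfl⟩ := mem_unitaryOrbit_iff.1 hN
  obtain ⟨Y, rfl⟩ := exists_unitaryConj_eq U X
  obtain ⟨Z, rfl⟩ := (unitaryConj_mem_stableSpace (isUnit_diagonal hd) lam U).1 hX
  have h := norm_fderiv_derivSub_le hd h0 h1 Z
  rw [fderiv_aluthge_apply, derivSub_unitaryConj U (isUnit_diagonal hd), ← map_add,
    norm_unitaryConj, norm_unitaryConj]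
  exact h

/-- The derivative of the Aluthge transform, as an endomorphism of the tangent space of the
similarity orbit at a point of the unitary orbit. -/
noncomputable def tangentMap {d : Fin r → ℂ} (hd : ∀ i, d i ≠ 0) (lam : ℝ) {N : Mat r}
    (hN : N ∈ unitaryOrbit (Matrix.diagonal d)) :
    tangentSpaceAt (similarityOrbit (Matrix.diagonal d)) N →ₗ[ℝ]
      tangentSpaceAt (similarityOrbit (Matrix.diagonal d)) N :=
  LinearMap.restrict (fderiv ℝ (aluthge lam) N : Mat r →ₗ[ℝ] Mat r) fun X hX => by
    change fderiv ℝ (aluthge lam) N X ∈ _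
    rw [fderiv_aluthge_apply]
    exact add_mem hX (stableSpace_le_tangentSpaceAt hd lam hN ⟨X, rfl⟩)

theorem tangentMap_apply {d : Fin r → ℂ} (hd : ∀ i, d i ≠ 0) (lam : ℝ) {N : Mat r}
    (hN : N ∈ unitaryOrbit (Matrix.diagonal d))
    (X : tangentSpaceAt (similarityOrbit (Matrix.diagonal d)) N) :
    (tangentMap hd lam hN X : Mat r) = fderiv ℝ (aluthge lam) N X := rfl

theorem isTangentMap_tangentMap {d : Fin r → ℂ} (hd : ∀ i, d i ≠ 0) (lam : ℝ) {N : Mat r}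
    (hN : N ∈ unitaryOrbit (Matrix.diagonal d)) :
    IsTangentMap (aluthge lam) (similarityOrbit (Matrix.diagonal d)) N (tangentMap hd lam hN) := by
  intro v γ h
  have hd' := ((contDiffAt_aluthge (isUnit_of_mem_unitaryOrbit hd hN) lam).differentiableAt
    (by simp)).hasFDerivAt
  rw [← h.base] at hd'
  have := hd'.comp_hasDerivAt 0 h.velocity
  rw [h.base] at this
  exact this

theorem stableSpace_eq_image {D : Mat r} (hD : IsUnit D) (lam : ℝ)
    (U : Matrix.unitaryGroup (Fin r) ℂ) :
    (stableSpace lam (unitaryConj U D) : Set (Mat r)) = unitaryConj U '' stableSpace lam D := by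
  ext X
  obtain ⟨Y, rfl⟩ := exists_unitaryConj_eq U X
  rw [(unitaryConj U).injective.mem_set_image]
  exact unitaryConj_mem_stableSpace hD lam U

theorem contDiffOn_derivSub (lam : ℝ) :
    ContDiffOn ℝ ∞ (derivSub (r := r) lam) {T | IsUnit T} := fun T hT => by
  have h := (contDiffAt_aluthge hT lam).fderiv_right (m := ∞) (by simp)
  exact (h.sub contDiffAt_const).contDiffWithinAt

theorem isOpen_setOf_isUnit : IsOpen {T : Mat r | IsUnit T} :=
  isOpen_iff_mem_nhds.2 fun _ hT => eventually_isUnit hT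

/-- On the kernel of `B_N` the operator `m(B_N)` is the scalar `m(0)`, and on the range it is `0`;
so `1 - m(B_N)/m(0)` is the projection. The polynomial found at `D` works at each `N` by
conjugation, and smoothness is inherited from `N ↦ B_N`. -/
theorem exists_smooth_projection {d : Fin r → ℂ} (hd : ∀ i, d i ≠ 0) {lam : ℝ}
    (h0 : 0 < lam) (h1 : lam < 1) :
    ∃ P : Mat r → BoundedOperator (Mat r),
      ContDiffOn ℝ ∞ P {T | IsUnit T} ∧ ∀ N ∈ unitaryOrbit (Matrix.diagonal d),
        (∀ X ∈ stableSpace lam N, P N X = X) ∧ ∀ X, derivSub lam N X = 0 → P N X = 0 := by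
  obtain ⟨m, hm0, hm⟩ := exists_aeval_apply_apply_eq_zero
    (f := derivSub lam (Matrix.diagonal d)) fun Y => derivSub_eq_zero_of_derivSub_derivSub hd h0 h1
  refine ⟨fun N => 1 - (m.eval 0)⁻¹ • Polynomial.aeval (derivSub lam N) m, ?_, fun N hN => ⟨?_, ?_⟩⟩
  · exact contDiffOn_const.sub
      (((contDiff_aeval m).comp_contDiffOn (contDiffOn_derivSub lam)).const_smul (m.eval 0)⁻¹)
  · obtain ⟨U, rfl⟩ := mem_unitaryOrbit_iff.1 hN
    intro X hX
    obtain ⟨Y, rfl⟩ := exists_unitaryConj_eq U X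
    obtain ⟨Z, rfl⟩ := (unitaryConj_mem_stableSpace (isUnit_diagonal hd) lam U).1 hX
    have h := aeval_apply_of_semiconj (C := unitaryConj U) (map_add _)
      (fun t x => map_smul _ t x) (derivSub_unitaryConj U (isUnit_diagonal hd) lam) m
      (derivSub lam (Matrix.diagonal d) Z)
    rw [hm, map_zero] at h
    change _ - (m.eval 0)⁻¹ • (Polynomial.aeval (derivSub lam (unitaryConj U _)) m
      (unitaryConj U (derivSub lam (Matrix.diagonal d) Z))) = _
    rw [h, smul_zero]
    exact sub_zero _
  · intro X hX
    have h := aeval_apply_of_apply_eq_zero hX m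
    change X - (m.eval 0)⁻¹ • (Polynomial.aeval (derivSub lam N) m X) = 0
    rw [h, inv_smul_smul₀ hm0, sub_self]

end StableSpace

end Aluthge

theorem theorem3p1 (r : ℕ) (d : Fin r → ℂ) (hd : ∀ i, d i ≠ 0) (D : Mat r)
    (hD : D = Matrix.diagonal d) (lam : ℝ) (hlam0 : 0 < lam) (hlam1 : lam < 1) :
    -- `Δ_λ` is a `C^∞` map of the similarity orbit of `D` into itself
    Set.MapsTo (aluthge lam) (similarityOrbit D) (similarityOrbit D) ∧
    SmoothOnSubset (aluthge lam) (similarityOrbit D) ∧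
    contractionConst d lam < 1 ∧
    ∃ Es : Mat r → Submodule ℝ (Mat r),
      (∀ N ∈ unitaryOrbit D,
        -- `N` is fixed by `Δ_λ`, so that the derivative at `N` acts on one tangent space
        aluthge lam N = N ∧
        -- the tangent space of the similarity orbit is the direct sum of `Es N` and the tangent
        -- space of the unitary orbit
        Es N ⊔ tangentSpaceAt (unitaryOrbit D) N = tangentSpaceAt (similarityOrbit D) N ∧
        Es N ⊓ tangentSpaceAt (unitaryOrbit D) N = ⊥ ∧
        -- the derivative `L` of `Δ_λ` at `N` leaves both summands invariant and contracts `Es N`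
        (∃ L : tangentSpaceAt (similarityOrbit D) N →ₗ[ℝ] tangentSpaceAt (similarityOrbit D) N,
          IsTangentMap (aluthge lam) (similarityOrbit D) N L ∧
          (∀ X : tangentSpaceAt (similarityOrbit D) N,
            (X : Mat r) ∈ Es N → (L X : Mat r) ∈ Es N) ∧
          (∀ X : tangentSpaceAt (similarityOrbit D) N,
            (X : Mat r) ∈ tangentSpaceAt (unitaryOrbit D) N →
              (L X : Mat r) ∈ tangentSpaceAt (unitaryOrbit D) N) ∧
          (∀ X : tangentSpaceAt (similarityOrbit D) N,
            (X : Mat r) ∈ Es N → ‖(L X : Mat r)‖ ≤ contractionConst d lam * ‖(X : Mat r)‖)) ∧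
        -- equivariance
        (∀ U ∈ Matrix.unitaryGroup (Fin r) ℂ, N = U * D * Uᴴ →
          (Es N : Set (Mat r)) = (fun X : Mat r => U * X * Uᴴ) '' (Es D : Set (Mat r)))) ∧
      -- `Es N` depends smoothly on `N`: the projection of the tangent space of the similarity
      -- orbit onto `Es N` parallel to the tangent space of the unitary orbit, extended by `0` to
      -- the orthogonal complement in the space of all matrices, is a smooth function of `N`
      ∃ P : Mat r → BoundedOperator (Mat r),
        SmoothOnSubset P (unitaryOrbit D) ∧
        ∀ N ∈ unitaryOrbit D,
          (∀ X ∈ Es N, P N X = X) ∧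
          (∀ X ∈ tangentSpaceAt (unitaryOrbit D) N, P N X = 0) ∧
          (∀ X : Mat r,
            (∀ Y ∈ tangentSpaceAt (similarityOrbit D) N, (Matrix.trace (Yᴴ * X)).re = 0) →
              P N X = 0) := by
  subst hD
  have hDu := isUnit_diagonal hd
  have hsub := unitaryOrbit_subset_similarityOrbit (Matrix.diagonal d)
  refine ⟨mapsTo_aluthge hDu lam, fun T hT => ⟨{T | IsUnit T}, aluthge lam, isOpen_setOf_isUnit,
    isUnit_of_mem_similarityOrbit hDu hT,
    fun X hX => (contDiffAt_aluthge hX lam).contDiffWithinAt, fun X _ => rfl⟩,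
    contractionConst_lt_one hd hlam0 hlam1, stableSpace lam, fun N hN => ⟨aluthge_eq_self hd lam hN,
      stableSpace_sup_tangentSpaceAt hd hlam0 hlam1 hN,
      stableSpace_inf_tangentSpaceAt hd hlam0 hlam1 hN,
      ⟨tangentMap hd lam hN, isTangentMap_tangentMap hd lam hN, fun X hX => ?_, fun X hX => ?_,
        fun X hX => norm_fderiv_le_of_mem_stableSpace hd hlam0 hlam1 hN hX⟩, ?_⟩, ?_⟩
  · rw [tangentMap_apply, fderiv_aluthge_apply]
    exact add_mem hX ⟨_, rfl⟩
  · rw [tangentMap_apply, fderiv_aluthge_apply,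
      derivSub_eq_zero_of_mem_tangentSpaceAt hd lam hN hX, add_zero]
    exact hX
  · rintro U hU rfl
    exact stableSpace_eq_image hDu lam ⟨U, hU⟩
  · obtain ⟨P, hP, hPN⟩ := exists_smooth_projection hd hlam0 hlam1
    exact ⟨P, fun N hN => ⟨{T | IsUnit T}, P, isOpen_setOf_isUnit,
      isUnit_of_mem_similarityOrbit hDu (hsub hN), hP, fun X _ => rfl⟩, fun N hN =>
      ⟨(hPN N hN).1, fun X hX =>
        (hPN N hN).2 X (derivSub_eq_zero_of_mem_tangentSpaceAt hd lam hN hX), fun X hX =>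
        (hPN N hN).2 X (derivSub_eq_zero_of_forall_trace hd lam hN hX)⟩⟩
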